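/- Monopolar Recognition can be solved in \(\mathcal{O}^{\star}(1.3734^{n})\) time. All graphs are finite, simple and undirected. A graph is a cluster graph if each of its connected components is a complete graph. A monopolar partition of a graph \(G=(V,E)\) is a partition \(V=C\uplus I\) (one of the parts may be empty) such that the induced subgraph \(G[C]\) is a cluster graph and \(I\) is an independent set in \(G\); the graph \(G\) is monopolar if it has a monopolar partition. There are an algorithm (for a deterministic random access machine) and a polynomial \(p\) such that, for every \(n\) and every graph \(G\) on \(n\) vertices, given by its adjacency matrix, the algorithm takes \(G\) as input, halts after at most \(p(n)\cdot 1.3734^{n}\) steps, and correctly decides whether \(G\) is monopolar. If \(G\) is monopolar, then the algorithm also outputs one monopolar partition of \(G\). -/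

import Mathlib

/-! ### Monopolar graphs -/

/-- A cluster graph: every connected component is a complete graph. -/
def IsClusterGraph {V : Type*} (G : SimpleGraph V) : Prop :=
  ∀ K : G.ConnectedComponent, G.induce K.supp = ⊤

/-- `(C, I)` is a monopolar partition of `G`: the sets `C` and `I` (possibly empty) partition the
vertex set, `C` induces a cluster graph and `I` is an independent set. -/
def IsMonopolarPartition {V : Type*} (G : SimpleGraph V) (C I : Set V) : Prop :=
  Disjoint C I ∧ C ∪ I = Set.univ ∧ IsClusterGraph (G.induce C) ∧ G.IsIndepSet I

/-- A graph is monopolar if it has a monopolar partition. -/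
def IsMonopolar {V : Type*} (G : SimpleGraph V) : Prop :=
  ∃ C I : Set V, IsMonopolarPartition G C I

/-! ### The machine model

Algorithms are programs of a deterministic random access machine with structured control flow.
A program uses finitely many scalar variables and finitely many arrays (a variable or an array is
named by a constant of the program), all of them holding natural numbers. Indirect addressing is
array access `a[i]` with `i` a variable. The only arithmetic operations are `+ 1` and `- 1`, so a
run of `t` steps can only create numbers of size at most (largest initial number or constant) + `t`,
and charging one time unit per instruction is realistic; addition, multiplication and so on
have to be programmed. Each instruction translates into a bounded number of instructions of any
of the usual random access machines. -/

/-- Contents of the memory: `var x` is the value of variable `x`, and `arr a i` is the value of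
cell `i` of array `a`. -/
structure Store where
  var : ℕ → ℕ
  arr : ℕ → ℕ → ℕ

/-- `s.setVar x v` is the store `s` after the assignment `x := v`. -/
def Store.setVar (s : Store) (x v : ℕ) : Store :=
  { s with var := Function.update s.var x v }

/-- `s.setArr a i v` is the store `s` after the assignment `a[i] := v`. -/
def Store.setArr (s : Store) (a i v : ℕ) : Store :=
  { s with arr := Function.update s.arr a (Function.update (s.arr a) i v) }

/-- Programs. -/
inductive Prog : Type where
  /-- do nothing -/
  | skip : Prog
  /-- `x := c` for a constant `c` -/
  | const (x c : ℕ) : Prog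
  /-- `x := y` -/
  | copy (x y : ℕ) : Prog
  /-- `x := x + 1` -/
  | incr (x : ℕ) : Prog
  /-- `x := x - 1`, where `0 - 1 = 0` -/
  | decr (x : ℕ) : Prog
  /-- `x := a[i]` for a variable `i` -/
  | load (x a i : ℕ) : Prog
  /-- `a[i] := x` for variables `i` and `x` -/
  | store (a i x : ℕ) : Prog
  /-- first `p`, then `q` -/
  | seq (p q : Prog) : Prog
  /-- `if x < y then p else q` for variables `x` and `y` -/
  | ifLt (x y : ℕ) (p q : Prog) : Prog
  /-- `while x < y do p` for variables `x` and `y` -/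
  | whileLt (x y : ℕ) (p : Prog) : Prog

/-- `Runs p s t s'`: the program `p`, started in the store `s`, halts after exactly `t` steps, in
the store `s'`. Every elementary instruction and every evaluation of a test costs one step. -/
inductive Runs : Prog → Store → ℕ → Store → Prop where
  | skip (s : Store) : Runs .skip s 1 s
  | const (x c : ℕ) (s : Store) : Runs (.const x c) s 1 (s.setVar x c)
  | copy (x y : ℕ) (s : Store) : Runs (.copy x y) s 1 (s.setVar x (s.var y))
  | incr (x : ℕ) (s : Store) : Runs (.incr x) s 1 (s.setVar x (s.var x + 1))
  | decr (x : ℕ) (s : Store) : Runs (.decr x) s 1 (s.setVar x (s.var x - 1))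
  | load (x a i : ℕ) (s : Store) : Runs (.load x a i) s 1 (s.setVar x (s.arr a (s.var i)))
  | store (a i x : ℕ) (s : Store) : Runs (.store a i x) s 1 (s.setArr a (s.var i) (s.var x))
  | seq {p q : Prog} {s s' s'' : Store} {t t' : ℕ} :
      Runs p s t s' → Runs q s' t' s'' → Runs (.seq p q) s (t + t') s''
  | ifTrue {x y : ℕ} {p q : Prog} {s s' : Store} {t : ℕ} :
      s.var x < s.var y → Runs p s t s' → Runs (.ifLt x y p q) s (t + 1) s'
  | ifFalse {x y : ℕ} {p q : Prog} {s s' : Store} {t : ℕ} :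
      ¬ s.var x < s.var y → Runs q s t s' → Runs (.ifLt x y p q) s (t + 1) s'
  | whileTrue {x y : ℕ} {p : Prog} {s s' s'' : Store} {t t' : ℕ} :
      s.var x < s.var y → Runs p s t s' → Runs (.whileLt x y p) s' t' s'' →
        Runs (.whileLt x y p) s (t + t' + 1) s''
  | whileFalse {x y : ℕ} {p : Prog} {s : Store} :
      ¬ s.var x < s.var y → Runs (.whileLt x y p) s 1 s

/-- The machine is deterministic: running time and final store are unique. -/
theorem Runs.unique {p : Prog} {s s₁ s₂ : Store} {t₁ t₂ : ℕ}
    (h₁ : Runs p s t₁ s₁) (h₂ : Runs p s t₂ s₂) : t₁ = t₂ ∧ s₁ = s₂ := by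
  induction h₁ generalizing t₂ s₂ with
  | seq _ _ ih ih' =>
    cases h₂ with
    | seq a b =>
      obtain ⟨rfl, rfl⟩ := ih a
      obtain ⟨rfl, rfl⟩ := ih' b
      exact ⟨rfl, rfl⟩
  | ifTrue hc _ ih =>
    cases h₂ with
    | ifTrue _ a => obtain ⟨rfl, rfl⟩ := ih a; exact ⟨rfl, rfl⟩
    | ifFalse hn _ => exact absurd hc hn
  | ifFalse hc _ ih =>
    cases h₂ with
    | ifTrue hn _ => exact absurd hn hc
    | ifFalse _ a => obtain ⟨rfl, rfl⟩ := ih a; exact ⟨rfl, rfl⟩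
  | whileTrue hc _ _ ih ih' =>
    cases h₂ with
    | whileTrue _ a b =>
      obtain ⟨rfl, rfl⟩ := ih a
      obtain ⟨rfl, rfl⟩ := ih' b
      exact ⟨rfl, rfl⟩
    | whileFalse hn => exact absurd hc hn
  | whileFalse hc =>
    cases h₂ with
    | whileTrue hn _ _ => exact absurd hn hc
    | whileFalse _ => exact ⟨rfl, rfl⟩
  | _ => cases h₂; exact ⟨rfl, rfl⟩

/-! ### Input and output of Monopolar Recognition -/

open Classical in
/-- The initial store for an input graph `G` with vertices `0, …, n - 1`: variable `0` holds `n`,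
array `0` holds the adjacency matrix of `G` row by row, and everything else is zero. -/
noncomputable def inputStore {n : ℕ} (G : SimpleGraph (Fin n)) : Store where
  var x := if x = 0 then n else 0
  arr a k := if a = 0 ∧ ∃ i j : Fin n, G.Adj i j ∧ k = i.val * n + j.val then 1 else 0

/-- The final store `s` is a correct output on the input graph `G`. If `G` is monopolar, then the
answer in variable `0` is `1` (Yes) and the first `n` cells of array `1` hold a monopolar partition
of `G`, where `1` marks the vertices of the cluster part and `0` those of the independent part.
If `G` is not monopolar, then the answer is `0` (No). -/
def IsCorrectOutput {n : ℕ} (G : SimpleGraph (Fin n)) (s : Store) : Prop :=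
  (IsMonopolar G → s.var 0 = 1 ∧
    IsMonopolarPartition G {v | s.arr 1 v.val = 1} {v | s.arr 1 v.val = 0}) ∧
  (¬ IsMonopolar G → s.var 0 = 0)

/-!
The algorithm is a branch-and-reduce search over partial colourings, in which some vertices have been
put into the cluster part, some into the independent part, and the others are undecided. A colouring
is a monopolar partition as soon as no edge lies in the independent part and no induced path on three
vertices lies in the cluster part (`isMonopolarPartition_iff`). Two undecided vertices are *linked* if
they induce such a path with a vertex of the cluster part, so that at least one of them belongs to
the independent part.

Branching on a vertex `a` means to try `a` in the independent part, where all its neighbours go to the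
cluster part, and in the cluster part, where all vertices linked to `a` go to the independent part and
the neighbours of those to the cluster part. If some vertices are linked and the reduction rules are
exhausted, then `a` can be chosen such that this decides at least 2 and 3 vertices respectively, and
`x⁻² + x⁻³ < 1` for `x = 1.3734`. If no vertices are linked, then the undecided part is unaffected by
earlier decisions. A leaf gives a branching with the same numbers (`weight_leafRule`). Otherwise
every undecided vertex has two undecided neighbours, and any vertex is branched on: at least 3
vertices are decided on one side, but only one on the other. On that side, however, new links appear,
and their structure (`early_putC`) guarantees that the next rule is a reduction, or a branching that
decides 2 and 4 or 3 and 3 vertices. The function `weight` gives a discount to such colourings, and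
with it every rule application decreases the total weight of the open colourings by at least one
(`Step.some`). The number of applications is therefore at most the initial weight,
which is at most `100 * 1.3734 ^ n`.

All rules, their guards and their effects alike, are given by first-order formulas over the
partially coloured graph. The machine program is built from a general evaluator for such formulas
(`evalProg`), whose running time is polynomial for each fixed formula, and keeps the open colourings
on a stack.
-/

namespace MonopolarRecognition

/-! ### Monopolar partitions as solutions of a constraint system -/

section Maths

variable {V : Type*} (G : SimpleGraph V)

/-- The vertices `x`, `y`, `z` are distinct and induce a path on three vertices, in any order. -/
def IsP3 (x y z : V) : Prop :=
  (G.Adj x y ∧ G.Adj y z ∧ ¬ G.Adj x z ∧ x ≠ z) ∨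
  (G.Adj x y ∧ G.Adj x z ∧ ¬ G.Adj y z ∧ y ≠ z) ∨
  (G.Adj x z ∧ G.Adj y z ∧ ¬ G.Adj x y ∧ x ≠ y)

/-- `C` is the cluster part of a monopolar partition: every edge meets `C`, and `C` contains no
induced path on three vertices. -/
def IsSolution (C : Set V) : Prop :=
  (∀ u v, G.Adj u v → u ∈ C ∨ v ∈ C) ∧ ∀ x ∈ C, ∀ y ∈ C, ∀ z ∈ C, ¬ IsP3 G x y z

variable {G}

theorem isClusterGraph_iff {W : Type*} {H : SimpleGraph W} :
    IsClusterGraph H ↔ ∀ x y z, H.Adj x y → H.Adj y z → x ≠ z → H.Adj x z := by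
  constructor
  · intro h x y z hxy hyz hxz
    have hK := h (H.connectedComponentMk y)
    have hx : x ∈ (H.connectedComponentMk y).supp := by
      simpa using hxy.reachable
    have hz : z ∈ (H.connectedComponentMk y).supp := by
      simpa using hyz.symm.reachable
    have : (H.induce (H.connectedComponentMk y).supp).Adj ⟨x, hx⟩ ⟨z, hz⟩ := by
      rw [hK]; simpa using hxz
    simpa using this
  · intro h K
    have key : ∀ x y, H.Reachable x y → x = y ∨ H.Adj x y := by
      intro x y hxy
      obtain ⟨w⟩ := hxy
      induction w with
      | nil => exact Or.inl rfl
      | cons hadj _ ih =>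
        rename_i u v w _
        by_cases huw : u = w
        · exact Or.inl huw
        · rcases ih with rfl | ih
          · exact Or.inr hadj
          · exact Or.inr (h _ _ _ hadj ih huw)
    ext ⟨x, hx⟩ ⟨y, hy⟩
    have hr : H.Reachable x y := by
      rw [SimpleGraph.ConnectedComponent.mem_supp_iff] at hx hy
      exact SimpleGraph.ConnectedComponent.exact (hx.trans hy.symm)
    have := key x y hr
    simp only [SimpleGraph.induce_adj, SimpleGraph.top_adj, ne_eq, Subtype.mk.injEq]
    exact ⟨fun h => h.ne, fun h => this.resolve_left h⟩

theorem isMonopolarPartition_iff {C I : Set V} :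
    IsMonopolarPartition G C I ↔ I = Cᶜ ∧ IsSolution G C := by
  have hI : Disjoint C I ∧ C ∪ I = Set.univ ↔ I = Cᶜ := by
    constructor
    · rintro ⟨h1, h2⟩
      exact (IsCompl.of_eq (Set.disjoint_iff_inter_eq_empty.mp h1) h2).compl_eq.symm
    · rintro rfl
      exact ⟨disjoint_compl_right, Set.union_compl_self C⟩
  unfold IsMonopolarPartition
  rw [← and_assoc, hI]
  refine and_congr_right ?_
  rintro rfl
  rw [isClusterGraph_iff, and_comm]
  refine and_congr ?_ ?_
  · constructor
    · intro h u v huv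
      by_contra hc
      push Not at hc
      exact h hc.1 hc.2 huv.ne huv
    · intro h u hu v hv _ huv
      rcases h u v huv with h | h
      · exact hu h
      · exact hv h
  · constructor
    · intro h x hx y hy z hz hp
      have h' : ∀ x ∈ C, ∀ y ∈ C, ∀ z ∈ C, G.Adj x y → G.Adj y z → x ≠ z → G.Adj x z :=
        fun x hx y hy z hz h1 h2 h3 => by
          simpa using h ⟨x, hx⟩ ⟨y, hy⟩ ⟨z, hz⟩ (by simpa using h1) (by simpa using h2)
            (by simpa using h3)
      rcases hp with ⟨h1, h2, h3, h4⟩ | ⟨h1, h2, h3, h4⟩ | ⟨h1, h2, h3, h4⟩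
      · exact h3 (h' x hx y hy z hz h1 h2 h4)
      · exact h3 (h' y hy x hx z hz h1.symm h2 h4)
      · exact h3 (h' x hx z hz y hy h1 h2.symm h4)
    · intro h x y z hxy hyz hxz
      by_contra hc
      exact h x x.2 y y.2 z z.2 (Or.inl ⟨by simpa using hxy, by simpa using hyz,
        by simpa using hc, fun e => hxz (Subtype.ext e)⟩)

theorem isMonopolar_iff : IsMonopolar G ↔ ∃ C, IsSolution G C := by
  simp [IsMonopolar, isMonopolarPartition_iff]

end Maths

/-! ### First-order formulas over a partially coloured graph -/

/-- First-order formulas about a graph with a partial colouring. Variables are numbered by de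
Bruijn levels: in the scope of `d` quantifiers the variables are `0, …, d - 1`, and the quantifier
`ex` binds variable `d`. -/
inductive Formula : Type where
  /-- vertex `i` has been put into the cluster part -/
  | isC (i : ℕ) : Formula
  /-- vertex `i` has been put into the independent part -/
  | isI (i : ℕ) : Formula
  | adj (i j : ℕ) : Formula
  | eq (i j : ℕ) : Formula
  | neg (φ : Formula) : Formula
  | conj (φ ψ : Formula) : Formula
  | ex (φ : Formula) : Formula

namespace Formula

/-- Truth of a formula at depth `d` under the assignment `ρ`. A colouring `s` gives colour `1` to
the vertices of the cluster part and `0` to those of the independent part; a vertex of any other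
colour is undecided. -/
def Holds {V : Type*} (G : SimpleGraph V) (s : V → ℕ) : Formula → ℕ → (ℕ → V) → Prop
  | isC i, _, ρ => s (ρ i) = 1
  | isI i, _, ρ => s (ρ i) = 0
  | adj i j, _, ρ => G.Adj (ρ i) (ρ j)
  | eq i j, _, ρ => ρ i = ρ j
  | neg φ, d, ρ => ¬ φ.Holds G s d ρ
  | conj φ ψ, d, ρ => φ.Holds G s d ρ ∧ ψ.Holds G s d ρ
  | ex φ, d, ρ => ∃ v, φ.Holds G s (d + 1) (Function.update ρ d v)

/-- At depth `d`, only variables below the current depth occur. -/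
def WellScoped : Formula → ℕ → Bool
  | isC i, d => i < d
  | isI i, d => i < d
  | adj i j, d => i < d && j < d
  | eq i j, d => i < d && j < d
  | neg φ, d => φ.WellScoped d
  | conj φ ψ, d => φ.WellScoped d && ψ.WellScoped d
  | ex φ, d => φ.WellScoped (d + 1)

def disj (φ ψ : Formula) : Formula := neg (conj (neg φ) (neg ψ))

def imp (φ ψ : Formula) : Formula := neg (conj φ (neg ψ))

def all (φ : Formula) : Formula := neg (ex (neg φ))

/-- Vertex `i` is undecided. -/
def free (i : ℕ) : Formula := conj (neg (isC i)) (neg (isI i))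

/-- The formula for `IsP3`. -/
def p3 (i j k : ℕ) : Formula :=
  disj (conj (conj (adj i j) (adj j k)) (conj (neg (adj i k)) (neg (eq i k))))
    (disj (conj (conj (adj i j) (adj i k)) (conj (neg (adj j k)) (neg (eq j k))))
      (conj (conj (adj i k) (adj j k)) (conj (neg (adj i j)) (neg (eq i j)))))

/-- The formula for `Linked`, at depth `d`. -/
def linked (d i j : ℕ) : Formula :=
  conj (free i) (conj (free j) (ex (conj (isC d) (p3 i j d))))

end Formula

/-- Vertex `u` is undecided. -/
def Free {V : Type*} (s : V → ℕ) (u : V) : Prop := s u ≠ 1 ∧ s u ≠ 0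

/-- Two undecided vertices are linked if they induce a path on three vertices with a vertex of the
cluster part, so that they cannot both be put into the cluster part. -/
def Linked {V : Type*} (G : SimpleGraph V) (s : V → ℕ) (a x : V) : Prop :=
  Free s a ∧ Free s x ∧ ∃ z, s z = 1 ∧ IsP3 G a x z

section Semantics

open Formula

variable {V : Type*} {G : SimpleGraph V} {s : V → ℕ} {d : ℕ} {ρ : ℕ → V}

@[simp] theorem holds_isC {i : ℕ} : (isC i).Holds G s d ρ ↔ s (ρ i) = 1 := Iff.rfl
@[simp] theorem holds_isI {i : ℕ} : (isI i).Holds G s d ρ ↔ s (ρ i) = 0 := Iff.rfl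
@[simp] theorem holds_adj {i j : ℕ} : (adj i j).Holds G s d ρ ↔ G.Adj (ρ i) (ρ j) := Iff.rfl
@[simp] theorem holds_eq {i j : ℕ} : (eq i j).Holds G s d ρ ↔ ρ i = ρ j := Iff.rfl
@[simp] theorem holds_neg {φ : Formula} : (neg φ).Holds G s d ρ ↔ ¬ φ.Holds G s d ρ := Iff.rfl
@[simp] theorem holds_conj {φ ψ : Formula} :
    (conj φ ψ).Holds G s d ρ ↔ φ.Holds G s d ρ ∧ ψ.Holds G s d ρ := Iff.rfl
@[simp] theorem holds_ex {φ : Formula} :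
    (ex φ).Holds G s d ρ ↔ ∃ v, φ.Holds G s (d + 1) (Function.update ρ d v) := Iff.rfl

@[simp] theorem holds_disj {φ ψ : Formula} :
    (disj φ ψ).Holds G s d ρ ↔ φ.Holds G s d ρ ∨ ψ.Holds G s d ρ := by
  simp only [disj, holds_neg, holds_conj]; tauto

@[simp] theorem holds_imp {φ ψ : Formula} :
    (imp φ ψ).Holds G s d ρ ↔ (φ.Holds G s d ρ → ψ.Holds G s d ρ) := by
  simp only [imp, holds_neg, holds_conj]; tauto

@[simp] theorem holds_all {φ : Formula} :
    (all φ).Holds G s d ρ ↔ ∀ v, φ.Holds G s (d + 1) (Function.update ρ d v) := by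
  simp [all]

@[simp] theorem holds_free {i : ℕ} : (free i).Holds G s d ρ ↔ Free s (ρ i) := Iff.rfl

@[simp] theorem holds_p3 {i j k : ℕ} :
    (p3 i j k).Holds G s d ρ ↔ IsP3 G (ρ i) (ρ j) (ρ k) := by
  simp [p3, IsP3, and_assoc]

@[simp] theorem holds_linked {i j : ℕ} (hi : i ≠ d) (hj : j ≠ d) :
    (linked d i j).Holds G s d ρ ↔ Linked G s (ρ i) (ρ j) := by
  simp [linked, Linked, hi, hj]

end Semantics

/-! ### The reduction and branching rules -/

/-- A rule of the algorithm. It applies to a vertex `a` (variable `0`) at which `guard` holds, and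
replaces the current colouring by the colourings described by `succs`: a pair `(φ, ψ)` stands for
the colouring in which the vertices `u` (variable `1`) with `φ` go to the cluster part, those
with `ψ` but not `φ` to the independent part, and all others keep their colour. -/
structure Rule where
  guard : Formula
  succs : List (Formula × Formula)

section Rules

open Formula

/-- Put `a` into the cluster part. The second formula is a contradiction. -/
def putC : Formula × Formula := (eq 1 0, conj (isC 0) (neg (isC 0)))

/-- Put `a` into the independent part. The first formula is a contradiction. -/
def putI : Formula × Formula := (conj (isC 0) (neg (isC 0)), eq 1 0)

/-- Put `a` into the independent part and its undecided neighbours into the cluster part. -/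
def chooseI : Formula × Formula := (conj (free 1) (adj 1 0), eq 1 0)

/-- Put `a` into the cluster part, the vertices linked to `a` into the independent part, and the
undecided neighbours of the latter into the cluster part. -/
def chooseC : Formula × Formula :=
  (disj (eq 1 0) (conj (free 1) (ex (conj (linked 3 0 2) (adj 1 2)))), linked 2 0 1)

/-- Vertex `i` is undecided and `j` is its only undecided neighbour (formula at depth `d`). -/
def leafAt (d i j : ℕ) : Formula :=
  conj (conj (free i) (adj i j)) (all (imp (conj (adj i d) (free d)) (eq d j)))

/-- Put `a` into the cluster part and the leaves at `a` into the independent part. -/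
def chooseLeaves : Formula × Formula := (eq 1 0, leafAt 2 1 0)

/-- An edge inside the independent part or an induced path on three vertices inside the cluster
part: give up. -/
def violationRule : Rule where
  guard := disj (conj (isI 0) (ex (conj (isI 1) (adj 0 1))))
    (conj (isC 0) (ex (conj (isC 1) (ex (conj (isC 2) (p3 0 1 2))))))
  succs := []

/-- A neighbour of the independent part goes to the cluster part. -/
def edgeRule : Rule where
  guard := conj (free 0) (ex (conj (isI 1) (adj 0 1)))
  succs := [putC]

/-- The third vertex of an induced path with two vertices of the cluster part goes to the independent
part. -/
def pathRule : Rule where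
  guard := conj (free 0) (ex (conj (isC 1) (ex (conj (isC 2) (p3 0 1 2)))))
  succs := [putI]

/-- A vertex with all neighbours in the cluster part may go to the independent part. -/
def isolatedRule : Rule where
  guard := conj (free 0) (all (imp (adj 0 1) (isC 1)))
  succs := [putI]

/-- One of two linked vertices lies in the independent part, so a common neighbour goes to the
cluster part. -/
def commonNeighbourRule : Rule where
  guard := conj (free 0) (ex (ex (conj (linked 3 1 2) (conj (adj 0 1) (adj 0 2)))))
  succs := [putC]

/-- A vertex linked to both ends of an edge goes to the independent part. -/
def adjacentPartnersRule : Rule where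
  guard := conj (free 0) (ex (ex (conj (conj (linked 3 0 1) (linked 3 0 2)) (adj 1 2))))
  succs := [putI]

/-- Two adjacent linked vertices that interact with no other undecided vertex. -/
def pairRule : Rule where
  guard := ex (conj (conj (adj 0 1) (linked 2 0 1)) (all (conj
    (conj (imp (conj (adj 2 0) (free 2)) (eq 2 1)) (imp (conj (adj 2 1) (free 2)) (eq 2 0)))
    (conj (imp (linked 3 0 2) (eq 2 1)) (imp (linked 3 1 2) (eq 2 0))))))
  succs := [putI]

/-- Branch on a vertex that is linked to two others. -/
def twoPartnersRule : Rule where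
  guard := ex (ex (conj (neg (eq 1 2)) (conj (linked 3 0 1) (linked 3 0 2))))
  succs := [chooseI, chooseC]

/-- Branch on `a` if it is linked to a neighbour `x`, and each of the two has a further undecided
neighbour. -/
def adjacentPairRule : Rule where
  guard := ex (conj (conj (adj 0 1) (linked 2 0 1)) (conj
    (ex (conj (conj (free 2) (adj 2 0)) (neg (eq 2 1))))
    (ex (conj (conj (free 2) (adj 2 1)) (neg (eq 2 0))))))
  succs := [chooseI, chooseC]

/-- Branch on `a` if it is linked to some `x` that has an undecided neighbour besides `a`. -/
def linkedRule : Rule where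
  guard := ex (conj (linked 2 0 1) (ex (conj (conj (free 2) (adj 2 1)) (neg (eq 2 0)))))
  succs := [chooseI, chooseC]

/-- If the component of `a` in the undecided part is a clique, then `a` may go to the cluster part,
provided that no vertices are linked. -/
def cliqueRule : Rule where
  guard := conj (free 0) (all (all (imp (conj (free 1) (free 2)) (neg (p3 0 1 2)))))
  succs := [putC]

/-- Branch on a vertex with leaves. -/
def leafRule : Rule where
  guard := conj (free 0) (ex (leafAt 2 1 0))
  succs := [chooseI, chooseLeaves]

/-- Branch on any undecided vertex. -/
def freeRule : Rule where
  guard := free 0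
  succs := [chooseI, chooseC]

/-- The rules whose application is cheap: a colouring to which one of them applies has
smaller weight (see `weight`). -/
def earlyRules : List Rule :=
  [violationRule, edgeRule, pathRule, isolatedRule, commonNeighbourRule, adjacentPartnersRule,
    pairRule, twoPartnersRule, adjacentPairRule]

/-- All rules, in the order of their priority. -/
def rules : List Rule := earlyRules ++ [linkedRule, cliqueRule, leafRule, freeRule]

variable {V : Type*} (G : SimpleGraph V) (s : V → ℕ)

/-- The rule `r` applies at the vertex `a`. -/
def Rule.Applies (r : Rule) (a : V) : Prop := r.guard.Holds G s 1 (fun _ => a)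

open Classical in
/-- The colouring described by the pair of formulas `f` for the vertex `a`. -/
noncomputable def recolour (a : V) (f : Formula × Formula) (u : V) : ℕ :=
  if f.1.Holds G s 2 (Function.update (fun _ => a) 1 u) then 1
  else if f.2.Holds G s 2 (Function.update (fun _ => a) 1 u) then 0 else s u

/-- The first applicable rule of the list `rs` turns the colouring `s` into the list `o` of
colourings; `o` is `none` if no rule applies. -/
def Step : List Rule → Option (List (V → ℕ)) → Prop
  | [], o => o = none
  | r :: rs, o => (∃ a, r.Applies G s a ∧ o = some (r.succs.map (recolour G s a))) ∨
      ((¬ ∃ a, r.Applies G s a) ∧ Step rs o)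

variable {G s} {a u : V}

theorem applies_violationRule : violationRule.Applies G s a ↔
    (s a = 0 ∧ ∃ b, s b = 0 ∧ G.Adj a b) ∨
      (s a = 1 ∧ ∃ b, s b = 1 ∧ ∃ c, s c = 1 ∧ IsP3 G a b c) := by
  simp [Rule.Applies, violationRule]

theorem applies_edgeRule :
    edgeRule.Applies G s a ↔ Free s a ∧ ∃ b, s b = 0 ∧ G.Adj a b := by
  simp [Rule.Applies, edgeRule]

theorem applies_pathRule : pathRule.Applies G s a ↔
    Free s a ∧ ∃ b, s b = 1 ∧ ∃ c, s c = 1 ∧ IsP3 G a b c := by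
  simp [Rule.Applies, pathRule]

theorem applies_isolatedRule : isolatedRule.Applies G s a ↔
    Free s a ∧ ∀ b, G.Adj a b → s b = 1 := by
  simp [Rule.Applies, isolatedRule]

theorem applies_commonNeighbourRule : commonNeighbourRule.Applies G s a ↔
    Free s a ∧ ∃ x y, Linked G s x y ∧ G.Adj a x ∧ G.Adj a y := by
  simp [Rule.Applies, commonNeighbourRule]

theorem applies_adjacentPartnersRule : adjacentPartnersRule.Applies G s a ↔
    Free s a ∧ ∃ x y, (Linked G s a x ∧ Linked G s a y) ∧ G.Adj x y := by
  simp [Rule.Applies, adjacentPartnersRule]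

theorem applies_pairRule : pairRule.Applies G s a ↔
    ∃ x, (G.Adj a x ∧ Linked G s a x) ∧ ∀ w,
      ((G.Adj w a ∧ Free s w → w = x) ∧ (G.Adj w x ∧ Free s w → w = a)) ∧
      ((Linked G s a w → w = x) ∧ (Linked G s x w → w = a)) := by
  simp [Rule.Applies, pairRule]

theorem applies_twoPartnersRule : twoPartnersRule.Applies G s a ↔
    ∃ x y, x ≠ y ∧ Linked G s a x ∧ Linked G s a y := by
  simp [Rule.Applies, twoPartnersRule]

theorem applies_adjacentPairRule : adjacentPairRule.Applies G s a ↔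
    ∃ x, (G.Adj a x ∧ Linked G s a x) ∧ (∃ b, (Free s b ∧ G.Adj b a) ∧ b ≠ x) ∧
      ∃ y, (Free s y ∧ G.Adj y x) ∧ y ≠ a := by
  simp [Rule.Applies, adjacentPairRule]

theorem applies_linkedRule : linkedRule.Applies G s a ↔
    ∃ x, Linked G s a x ∧ ∃ y, (Free s y ∧ G.Adj y x) ∧ y ≠ a := by
  simp [Rule.Applies, linkedRule]

theorem applies_cliqueRule : cliqueRule.Applies G s a ↔
    Free s a ∧ ∀ p q, Free s p ∧ Free s q → ¬ IsP3 G a p q := by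
  simp [Rule.Applies, cliqueRule]

/-- The vertex `v` is undecided, and `a` is its only undecided neighbour. -/
def IsLeafAt (G : SimpleGraph V) (s : V → ℕ) (v a : V) : Prop :=
  (Free s v ∧ G.Adj v a) ∧ ∀ w, G.Adj v w ∧ Free s w → w = a

theorem applies_leafRule : leafRule.Applies G s a ↔
    Free s a ∧ ∃ v, IsLeafAt G s v a := by
  simp [Rule.Applies, leafRule, leafAt, IsLeafAt]

theorem applies_freeRule : freeRule.Applies G s a ↔ Free s a := by
  simp [Rule.Applies, freeRule]

open Classical in
theorem recolour_putC : recolour G s a putC u = if u = a then 1 else s u := by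
  simp [recolour, putC]

open Classical in
theorem recolour_putI : recolour G s a putI u = if u = a then 0 else s u := by
  simp [recolour, putI]

open Classical in
theorem recolour_chooseI : recolour G s a chooseI u =
    if Free s u ∧ G.Adj u a then 1 else if u = a then 0 else s u := by
  simp [recolour, chooseI]

open Classical in
theorem recolour_chooseC : recolour G s a chooseC u =
    if u = a ∨ (Free s u ∧ ∃ x, Linked G s a x ∧ G.Adj u x) then 1
    else if Linked G s a u then 0 else s u := by
  simp [recolour, chooseC]

open Classical in
theorem recolour_chooseLeaves : recolour G s a chooseLeaves u =
    if u = a then 1 else if IsLeafAt G s u a then 0 else s u := by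
  simp [recolour, chooseLeaves, leafAt, IsLeafAt]

end Rules

/-! ### The rules preserve solvability -/

section Soundness

variable {V : Type*} {G : SimpleGraph V} {s : V → ℕ} {C : Set V} {a : V}

/-- The cluster part `C` respects the colours already given by `s`. -/
def Extends (s : V → ℕ) (C : Set V) : Prop := ∀ u, (s u = 1 → u ∈ C) ∧ (s u = 0 → u ∉ C)

/-- The colouring `s` can be completed to a monopolar partition. -/
def Solvable (G : SimpleGraph V) (s : V → ℕ) : Prop := ∃ C, IsSolution G C ∧ Extends s C

theorem IsP3.rotate {x y z : V} (h : IsP3 G x y z) : IsP3 G y z x := by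
  simp only [IsP3] at *
  grind [SimpleGraph.adj_comm]

theorem IsP3.swap {x y z : V} (h : IsP3 G x y z) : IsP3 G y x z := by
  simp only [IsP3] at *
  grind [SimpleGraph.adj_comm]

theorem Linked.symm {x y : V} (h : Linked G s x y) : Linked G s y x :=
  ⟨h.2.1, h.1, h.2.2.imp fun _ hz => ⟨hz.1, hz.2.swap⟩⟩

theorem Linked.ne {x y : V} (h : Linked G s x y) : x ≠ y := by
  rintro rfl
  obtain ⟨_, _, z, _, hz⟩ := h
  simp [IsP3] at hz

theorem Linked.not_mem {x y : V} (hC : IsSolution G C) (hs : Extends s C) (h : Linked G s x y)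
    (hx : x ∈ C) : y ∉ C := fun hy => by
  obtain ⟨_, _, z, hz, hp⟩ := h
  exact hC.2 x hx y hy z ((hs z).1 hz) hp

theorem Extends.putC (hs : Extends s C) (ha : a ∈ C) : Extends (recolour G s a putC) C := by
  intro u
  rw [recolour_putC]
  split_ifs with h
  · subst h; simpa using ha
  · exact hs u

theorem Extends.putI (hs : Extends s C) (ha : a ∉ C) : Extends (recolour G s a putI) C := by
  intro u
  rw [recolour_putI]
  split_ifs with h
  · subst h; simpa using ha
  · exact hs u

theorem Extends.chooseI (hC : IsSolution G C) (hs : Extends s C) (ha : a ∉ C) :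
    Extends (recolour G s a chooseI) C := by
  intro u
  rw [recolour_chooseI]
  split_ifs with h h'
  · simpa using (hC.1 u a h.2).resolve_right ha
  · subst h'; simpa using ha
  · exact hs u

theorem Extends.chooseC (hC : IsSolution G C) (hs : Extends s C) (ha : a ∈ C) :
    Extends (recolour G s a chooseC) C := by
  intro u
  rw [recolour_chooseC]
  split_ifs with h h'
  · rcases h with rfl | ⟨-, x, hx, hux⟩
    · simpa using ha
    · simpa using (hC.1 u x hux).resolve_right (hx.not_mem hC hs ha)
  · simpa using h'.not_mem hC hs ha
  · exact hs u

theorem solvable_branch (h : Solvable G s) :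
    ∃ s' ∈ [recolour G s a chooseI, recolour G s a chooseC], Solvable G s' := by
  obtain ⟨C, hC, hs⟩ := h
  by_cases ha : a ∈ C
  · exact ⟨_, by simp, C, hC, hs.chooseC hC ha⟩
  · exact ⟨_, by simp, C, hC, hs.chooseI hC ha⟩

/-- Removing from `C` vertices without neighbours outside `C`, no two of them adjacent,
yields a solution again. -/
theorem IsSolution.diff {L : Set V} (hC : IsSolution G C)
    (hL : ∀ v ∈ L, ∀ w, G.Adj v w → w ∈ C ∧ w ∉ L) : IsSolution G (C \ L) := by
  refine ⟨fun u v huv => ?_, fun x hx y hy z hz => hC.2 x hx.1 y hy.1 z hz.1⟩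
  have h1 := hL u
  have h2 := hL v
  have h3 := hC.1 u v huv
  have h4 := huv.symm
  simp only [Set.mem_sdiff]
  grind

theorem solvable_isolatedRule (hr : isolatedRule.Applies G s a) (h : Solvable G s) :
    Solvable G (recolour G s a putI) := by
  rw [applies_isolatedRule] at hr
  obtain ⟨C, hC, hs⟩ := h
  have hs' : Extends s (C \ {a}) := by
    intro u
    have := hs u
    have h1 := hr.1.1
    simp only [Set.mem_sdiff, Set.mem_singleton_iff]
    grind
  refine ⟨C \ {a}, hC.diff ?_, hs'.putI (by simp)⟩
  rintro v rfl w hvw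
  exact ⟨(hs w).1 (hr.2 w hvw), fun e => hvw.ne e.symm⟩

theorem solvable_edgeRule (hr : edgeRule.Applies G s a) (h : Solvable G s) :
    Solvable G (recolour G s a putC) := by
  rw [applies_edgeRule] at hr
  obtain ⟨C, hC, hs⟩ := h
  obtain ⟨_, b, hb, hab⟩ := hr
  exact ⟨C, hC, hs.putC ((hC.1 a b hab).resolve_right ((hs b).2 hb))⟩

theorem solvable_pathRule (hr : pathRule.Applies G s a) (h : Solvable G s) :
    Solvable G (recolour G s a putI) := by
  rw [applies_pathRule] at hr
  obtain ⟨C, hC, hs⟩ := h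
  obtain ⟨_, b, hb, c, hc, hp⟩ := hr
  exact ⟨C, hC, hs.putI fun ha => hC.2 a ha b ((hs b).1 hb) c ((hs c).1 hc) hp⟩

theorem solvable_commonNeighbourRule (hr : commonNeighbourRule.Applies G s a)
    (h : Solvable G s) : Solvable G (recolour G s a putC) := by
  rw [applies_commonNeighbourRule] at hr
  obtain ⟨C, hC, hs⟩ := h
  obtain ⟨_, x, y, hxy, hax, hay⟩ := hr
  refine ⟨C, hC, hs.putC ?_⟩
  by_contra ha
  exact hxy.not_mem hC hs ((hC.1 a x hax).resolve_left ha) ((hC.1 a y hay).resolve_left ha)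

theorem solvable_adjacentPartnersRule (hr : adjacentPartnersRule.Applies G s a)
    (h : Solvable G s) : Solvable G (recolour G s a putI) := by
  rw [applies_adjacentPartnersRule] at hr
  obtain ⟨C, hC, hs⟩ := h
  obtain ⟨_, x, y, ⟨hx, hy⟩, hxy⟩ := hr
  refine ⟨C, hC, hs.putI fun ha => ?_⟩
  exact (hC.1 x y hxy).elim (hx.not_mem hC hs ha) (hy.not_mem hC hs ha)

theorem not_free_cases (u : V) : Free s u ∨ s u = 1 ∨ s u = 0 := by
  unfold Free; tauto

/-- In the situation of `pairRule`, exactly one of `a`, `x` is in the cluster part, and exchanging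
the two does no harm. -/
theorem solvable_pairRule (h1 : ¬ ∃ a, edgeRule.Applies G s a)
    (h2 : ¬ ∃ a, pathRule.Applies G s a) (hr : pairRule.Applies G s a)
    (h : Solvable G s) : Solvable G (recolour G s a putI) := by
  simp only [applies_edgeRule, applies_pathRule, not_exists, not_and] at h1 h2
  rw [applies_pairRule] at hr
  obtain ⟨C, hC, hs⟩ := h
  obtain ⟨x, ⟨hax, hl⟩, hw⟩ := hr
  by_cases ha : a ∉ C
  · exact ⟨C, hC, hs.putI ha⟩
  rw [not_not] at ha
  have hne := hl.ne
  have hs' : Extends s (insert x (C \ {a})) := by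
    intro u
    have := hs u
    have h1 := hl.1
    have h2 := hl.2.1
    simp only [Set.mem_insert_iff, Set.mem_sdiff, Set.mem_singleton_iff]
    unfold Free at h1 h2
    grind
  -- a neighbour of `a` other than `x`
  have hna : ∀ w, G.Adj a w → w ≠ x → w ∈ C := fun w haw hwx => by
    rcases not_free_cases (s := s) w with hf | h | h
    · exact absurd ((hw w).1.1 ⟨haw.symm, hf⟩) hwx
    · exact (hs w).1 h
    · exact absurd haw (h1 a hl.1 w h)
  have key : ∀ p ∈ C \ {a}, ∀ q ∈ C \ {a}, ¬ IsP3 G x p q := by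
    intro p hp q hq hP
    have hcol : ∀ w ∈ C \ {a}, Free s w ∨ s w = 1 := fun w hw => by
      rcases not_free_cases (s := s) w with hf | h | h
      · exact Or.inl hf
      · exact Or.inr h
      · exact absurd hw.1 ((hs w).2 h)
    have hlink : ∀ w z, w ∈ C \ {a} → Free s w → s z = 1 → ¬ IsP3 G x w z :=
      fun w z hwC hf hz hP => hwC.2 ((hw w).2.2 ⟨hl.2.1, hf, z, hz, hP⟩)
    rcases hcol p hp with hfp | hp1 <;> rcases hcol q hq with hfq | hq1
    · have : G.Adj x p ∨ G.Adj x q := by unfold IsP3 at hP; tauto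
      rcases this with h | h
      · exact hp.2 ((hw p).1.2 ⟨h.symm, hfp⟩)
      · exact hq.2 ((hw q).1.2 ⟨h.symm, hfq⟩)
    · exact hlink p q hp hfp hq1 hP
    · exact hlink q p hq hfq hp1 (hP.rotate.rotate.swap)
    · exact h2 x hl.2.1 p hp1 q hq1 hP
  refine ⟨insert x (C \ {a}), ⟨?_, ?_⟩, hs'.putI (by simp [hne])⟩
  · intro u v huv
    have h3 := hC.1 u v huv
    have h4 := hna u
    have h5 := hna v
    have h6 := huv.symm
    have h7 := huv.ne
    simp only [Set.mem_insert_iff, Set.mem_sdiff, Set.mem_singleton_iff]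
    grind
  · intro p hp q hq r hr hP
    have self2 : ∀ p q, ¬ IsP3 G p p q := fun p q h => by
      unfold IsP3 at h; grind [SimpleGraph.adj_comm, SimpleGraph.irrefl]
    rcases hp with rfl | hp
    · rcases hq with rfl | hq
      · exact self2 _ _ hP
      · rcases hr with rfl | hr
        · exact self2 _ _ hP.rotate.rotate
        · exact key q hq r hr hP
    · rcases hq with rfl | hq
      · rcases hr with rfl | hr
        · exact self2 _ _ hP.rotate
        · exact key p hp r hr hP.swap
      · rcases hr with rfl | hr
        · exact key p hp q hq hP.rotate.rotate
        · exact hC.2 p hp.1 q hq.1 r hr.1 hP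

/-- In the situation of `cliqueRule`, when no vertices are linked, the component of `a` in the
undecided part is a clique all of which may go to the cluster part. -/
theorem solvable_cliqueRule (h2 : ¬ ∃ a, pathRule.Applies G s a)
    (hl : ∀ x y, ¬ Linked G s x y) (hr : cliqueRule.Applies G s a)
    (h : Solvable G s) : Solvable G (recolour G s a putC) := by
  simp only [applies_pathRule, not_exists, not_and] at h2
  rw [applies_cliqueRule] at hr
  obtain ⟨C, hC, hs⟩ := h
  set K : Set V := {u | Free s u ∧ (u = a ∨ G.Adj a u)} with hK
  have hs' : Extends s (C ∪ K) := by
    intro u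
    have := hs u
    simp only [Set.mem_union, hK, Set.mem_ofPred_eq, Free]
    grind
  have hcol : ∀ w ∈ C ∪ K, Free s w ∨ s w = 1 := fun w hw => by
    rcases not_free_cases (s := s) w with hf | h | h
    · exact Or.inl hf
    · exact Or.inr h
    · exact absurd hw ((hs' w).2 h)
  -- the set `K` is closed under undecided neighbours
  have hclosed : ∀ k ∈ K, ∀ w, Free s w → G.Adj k w → w ∈ K := by
    rintro k ⟨hk, rfl | hak⟩ w hw hkw
    · exact ⟨hw, Or.inr hkw⟩
    · refine ⟨hw, ?_⟩
      by_contra hc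
      push Not at hc
      exact hr.2 k w ⟨hk, hw⟩ (Or.inl ⟨hak, hkw, hc.2, hc.1.symm⟩)
  have hclique : ∀ p ∈ K, ∀ q ∈ K, p ≠ q → G.Adj p q := by
    rintro p ⟨hp, hp'⟩ q ⟨hq, hq'⟩ hpq
    rcases hp' with rfl | hp' <;> rcases hq' with rfl | hq'
    · exact absurd rfl hpq
    · exact hq'
    · exact hp'.symm
    · by_contra hc
      exact hr.2 p q ⟨hp, hq⟩ (Or.inr (Or.inl ⟨hp', hq', hc, hpq⟩))
  have key : ∀ k ∈ K, ∀ p ∈ C ∪ K, ∀ q ∈ C ∪ K, ¬ IsP3 G k p q := by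
    intro k hk p hp q hq hP
    rcases hcol p hp with hfp | hp1 <;> rcases hcol q hq with hfq | hq1
    · have hpK : p ∈ K ∧ q ∈ K := by
        rcases hP with ⟨h1, h2, _⟩ | ⟨h1, h2, _⟩ | ⟨h1, h2, _⟩
        · have := hclosed k hk p hfp h1
          exact ⟨this, hclosed p this q hfq h2⟩
        · exact ⟨hclosed k hk p hfp h1, hclosed k hk q hfq h2⟩
        · have := hclosed k hk q hfq h1
          exact ⟨hclosed q this p hfp h2.symm, this⟩
      rcases hP with ⟨h1, h2, h3, h4⟩ | ⟨h1, h2, h3, h4⟩ | ⟨h1, h2, h3, h4⟩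
      · exact h3 (hclique k hk q hpK.2 h4)
      · exact h3 (hclique p hpK.1 q hpK.2 h4)
      · exact h3 (hclique k hk p hpK.1 h4)
    · exact hl k p ⟨hk.1, hfp, q, hq1, hP⟩
    · exact hl k q ⟨hk.1, hfq, p, hp1, hP.rotate.rotate.swap⟩
    · exact h2 k hk.1 p hp1 q hq1 hP
  refine ⟨C ∪ K, ⟨fun u v huv => (hC.1 u v huv).imp Or.inl Or.inl, ?_⟩,
    hs'.putC (Or.inr ⟨hr.1, Or.inl rfl⟩)⟩
  intro p hp q hq r hr' hP
  rcases id hp with hp' | hp'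
  · rcases id hq with hq' | hq'
    · rcases hr' with hr' | hr'
      · exact hC.2 p hp' q hq' r hr' hP
      · exact key r hr' p hp q hq hP.rotate.rotate
    · exact key q hq' p hp r hr' hP.swap
  · exact key p hp' q hq r hr' hP

/-- Leaves at a vertex of the cluster part may go to the independent part. -/
theorem solvable_leafRule (h1 : ¬ ∃ a, edgeRule.Applies G s a) (hr : leafRule.Applies G s a)
    (h : Solvable G s) :
    ∃ s' ∈ [recolour G s a chooseI, recolour G s a chooseLeaves], Solvable G s' := by
  simp only [applies_edgeRule, not_exists, not_and] at h1
  rw [applies_leafRule] at hr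
  obtain ⟨C, hC, hs⟩ := h
  by_cases ha : a ∈ C
  · refine ⟨recolour G s a chooseLeaves, by simp, C \ {v | IsLeafAt G s v a}, hC.diff ?_, ?_⟩
    · intro v hv w hvw
      have hwa : ¬ IsLeafAt G s a a := fun h => G.irrefl h.1.2
      rcases not_free_cases (s := s) w with hf | h | h
      · obtain rfl := hv.2 w ⟨hvw, hf⟩
        exact ⟨ha, hwa⟩
      · exact ⟨(hs w).1 h, fun hl => hl.1.1.1 h⟩
      · exact absurd hvw (h1 v hv.1.1 w h)
    · intro u
      rw [recolour_chooseLeaves]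
      have hwa : ¬ IsLeafAt G s a a := fun h => G.irrefl h.1.2
      have := hs u
      simp only [Set.mem_sdiff, Set.mem_ofPred_eq]
      have h3 : IsLeafAt G s u a → s u ≠ 1 := fun h => h.1.1.1
      split_ifs with h h'
      · subst h; simp [ha, hwa]
      · simp [h']
      · grind
  · exact ⟨_, by simp, C, hC, hs.chooseI hC ha⟩

end Soundness

/-! ### The number of undecided vertices -/

section Counting

variable {V : Type*} {G : SimpleGraph V} {s : V → ℕ} {a : V}

theorem free_recolour_putC {u : V} : Free (recolour G s a putC) u ↔ Free s u ∧ u ≠ a := by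
  unfold Free; rw [recolour_putC]; grind

theorem free_recolour_putI {u : V} : Free (recolour G s a putI) u ↔ Free s u ∧ u ≠ a := by
  unfold Free; rw [recolour_putI]; grind

theorem free_recolour_chooseI {u : V} :
    Free (recolour G s a chooseI) u ↔ Free s u ∧ u ≠ a ∧ ¬ G.Adj u a := by
  unfold Free; rw [recolour_chooseI]; unfold Free; grind

theorem free_recolour_chooseC {u : V} : Free (recolour G s a chooseC) u ↔
    Free s u ∧ u ≠ a ∧ (¬ ∃ x, Linked G s a x ∧ G.Adj u x) ∧ ¬ Linked G s a u := by
  unfold Free; rw [recolour_chooseC]; unfold Free; grind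

theorem free_recolour_chooseLeaves {u : V} : Free (recolour G s a chooseLeaves) u ↔
    Free s u ∧ u ≠ a ∧ ¬ IsLeafAt G s u a := by
  unfold Free; rw [recolour_chooseLeaves]; grind

theorem recolour_chooseC_of_not_linked (h : ∀ x y, ¬ Linked G s x y) :
    recolour G s a chooseC = recolour G s a putC := by
  ext u
  rw [recolour_chooseC, recolour_putC]
  have h₁ : ¬ ∃ x, Linked G s a x ∧ G.Adj u x := fun ⟨x, hx, _⟩ => h a x hx
  by_cases hu : u = a
  · rw [if_pos (Or.inl hu), if_pos hu]
  · rw [if_neg (fun h' => h'.elim hu fun h'' => h₁ h''.2), if_neg (h a u), if_neg hu]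

/-- If no vertex can be decided by its neighbours alone, no undecided vertex is isolated among the
undecided ones. -/
theorem exists_free_neighbour (h1 : ¬ ∃ a, edgeRule.Applies G s a)
    (h3 : ¬ ∃ a, isolatedRule.Applies G s a) (ha : Free s a) : ∃ b, G.Adj a b ∧ Free s b := by
  simp only [applies_edgeRule, applies_isolatedRule, not_exists, not_and, not_forall] at h1 h3
  obtain ⟨b, hab, hb⟩ := h3 a ha
  exact ⟨b, hab, hb, fun h => h1 a ha b h hab⟩

variable [Fintype V]

open Classical in
/-- The number of undecided vertices. -/
noncomputable def freeCard (s : V → ℕ) : ℕ := (Finset.univ.filter (Free s)).card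

theorem freeCard_add_le {s' : V → ℕ} (hsub : ∀ u, Free s' u → Free s u) (S : Finset V)
    (hS : ∀ u ∈ S, Free s u ∧ ¬ Free s' u) : freeCard s' + S.card ≤ freeCard s := by
  classical
  unfold freeCard
  rw [← Finset.card_union_of_disjoint]
  · apply Finset.card_le_card
    intro u hu
    rcases Finset.mem_union.mp hu with h | h
    · simpa using hsub u (by simpa using h)
    · simpa using (hS u h).1
  · rw [Finset.disjoint_left]
    intro u hu hu'
    exact (hS u hu').2 (by simpa using hu)

end Counting

/-! ### The weight of a colouring -/

section Weight

variable {V : Type*} [Fintype V] {G : SimpleGraph V} {s : V → ℕ} {a : V}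

/-- One of the early rules applies. -/
def Early (G : SimpleGraph V) (s : V → ℕ) : Prop := ∃ r ∈ earlyRules, ∃ a, r.Applies G s a

open Classical in
/-- An upper bound for the size of the search tree below the colouring `s`. The discount for
colourings to which an early rule applies pays for the branch of `freeRule` that decides
only one vertex: with `x = 1.3734` and weights relative to `x ^ freeCard s`, the constant `82.5` exceeds
`100 * (x⁻² + x⁻⁴) + 1`, and `100 * x⁻³ + 82.5 * x⁻¹ + 1` is still at most `100`. -/
noncomputable def weight (G : SimpleGraph V) (s : V → ℕ) : ℝ :=
  (if Early G s then 82.5 else 100) * 1.3734 ^ freeCard s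

theorem weight_pos : 0 < weight G s := by
  unfold weight; split_ifs <;> positivity

theorem weight_le : weight G s ≤ 100 * 1.3734 ^ freeCard s := by
  unfold weight
  gcongr
  split_ifs <;> norm_num

theorem weight_mul_le {s' : V → ℕ} {k : ℕ} (h : freeCard s' + k ≤ freeCard s) :
    weight G s' * 1.3734 ^ k ≤ 100 * 1.3734 ^ freeCard s := by
  calc weight G s' * 1.3734 ^ k ≤ 100 * 1.3734 ^ freeCard s' * 1.3734 ^ k := by
        gcongr; exact weight_le
    _ = 100 * 1.3734 ^ (freeCard s' + k) := by rw [pow_add]; ring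
    _ ≤ _ := by gcongr; norm_num

theorem one_le_pow_freeCard : (1 : ℝ) ≤ 1.3734 ^ freeCard s := one_le_pow₀ (by norm_num)

theorem weight_le_one {s' : V → ℕ} (h : freeCard s' + 1 ≤ freeCard s) :
    weight G s' ≤ 72.82 * 1.3734 ^ freeCard s := by
  have := weight_mul_le (G := G) h
  have := one_le_pow_freeCard (s := s)
  linarith

theorem weight_le_two {s' : V → ℕ} (h : freeCard s' + 2 ≤ freeCard s) :
    weight G s' ≤ 53.02 * 1.3734 ^ freeCard s := by
  have := weight_mul_le (G := G) h
  have := one_le_pow_freeCard (s := s)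
  linarith

theorem weight_le_three {s' : V → ℕ} (h : freeCard s' + 3 ≤ freeCard s) :
    weight G s' ≤ 38.61 * 1.3734 ^ freeCard s := by
  have := weight_mul_le (G := G) h
  have := one_le_pow_freeCard (s := s)
  linarith

theorem weight_le_four {s' : V → ℕ} (h : freeCard s' + 4 ≤ freeCard s) :
    weight G s' ≤ 28.11 * 1.3734 ^ freeCard s := by
  have := weight_mul_le (G := G) h
  have := one_le_pow_freeCard (s := s)
  linarith

theorem weight_le_early {s' : V → ℕ} (h : freeCard s' + 1 ≤ freeCard s) (he : Early G s') :
    weight G s' ≤ 60.08 * 1.3734 ^ freeCard s := by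
  have h1 : (1.3734 : ℝ) ^ (freeCard s' + 1) ≤ 1.3734 ^ freeCard s := by
    gcongr; norm_num
  have := one_le_pow_freeCard (s := s)
  rw [weight, if_pos he]
  rw [pow_succ] at h1
  linarith

theorem weight_eq_early (he : Early G s) : weight G s = 82.5 * 1.3734 ^ freeCard s := by
  rw [weight, if_pos he]

theorem weight_eq_late (he : ¬ Early G s) : weight G s = 100 * 1.3734 ^ freeCard s := by
  rw [weight, if_neg he]

theorem freeCard_putC (ha : Free s a) : freeCard (recolour G s a putC) + 1 ≤ freeCard s := by
  simpa using freeCard_add_le (s' := recolour G s a putC)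
    (fun u hu => (free_recolour_putC.mp hu).1) {a}
    (by simp only [free_recolour_putC]; simpa using ha)

theorem freeCard_putI (ha : Free s a) : freeCard (recolour G s a putI) + 1 ≤ freeCard s := by
  simpa using freeCard_add_le (s' := recolour G s a putI)
    (fun u hu => (free_recolour_putI.mp hu).1) {a}
    (by simp only [free_recolour_putI]; simpa using ha)

theorem freeCard_chooseI {S : Finset V} (hS : ∀ u ∈ S, Free s u ∧ (u = a ∨ G.Adj u a)) :
    freeCard (recolour G s a chooseI) + S.card ≤ freeCard s := by
  refine freeCard_add_le (fun u hu => (free_recolour_chooseI.mp hu).1) S fun u hu => ?_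
  rw [free_recolour_chooseI]
  exact ⟨(hS u hu).1, by have := hS u hu; tauto⟩

theorem freeCard_chooseC {S : Finset V} (hS : ∀ u ∈ S, Free s u ∧
      (u = a ∨ Linked G s a u ∨ ∃ x, Linked G s a x ∧ G.Adj u x)) :
    freeCard (recolour G s a chooseC) + S.card ≤ freeCard s := by
  refine freeCard_add_le (fun u hu => (free_recolour_chooseC.mp hu).1) S fun u hu => ?_
  rw [free_recolour_chooseC]
  refine ⟨(hS u hu).1, fun ⟨_, h₁, h₂, h₃⟩ => ?_⟩
  exact (hS u hu).2.elim h₁ fun h => h.elim h₃ h₂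

theorem freeCard_chooseLeaves {v : V} (ha : Free s a) (hv : IsLeafAt G s v a) :
    freeCard (recolour G s a chooseLeaves) + 2 ≤ freeCard s := by
  classical
  have hav : a ≠ v := fun h => by subst h; exact G.irrefl hv.1.2
  rw [← Finset.card_pair hav]
  refine freeCard_add_le (fun u hu => (free_recolour_chooseLeaves.mp hu).1) _ fun u hu => ?_
  rw [free_recolour_chooseLeaves]
  simp only [Finset.mem_insert, Finset.mem_singleton] at hu
  rcases hu with rfl | rfl
  · exact ⟨ha, by tauto⟩
  · exact ⟨hv.1.1, by tauto⟩

theorem chooseI_two (h1 : ¬ ∃ a, edgeRule.Applies G s a)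
    (h3 : ¬ ∃ a, isolatedRule.Applies G s a) (ha : Free s a) :
    freeCard (recolour G s a chooseI) + 2 ≤ freeCard s := by
  classical
  obtain ⟨b, hab, hb⟩ := exists_free_neighbour h1 h3 ha
  rw [← Finset.card_pair hab.ne]
  refine freeCard_chooseI fun u hu => ?_
  simp only [Finset.mem_insert, Finset.mem_singleton] at hu
  rcases hu with rfl | rfl
  · exact ⟨ha, Or.inl rfl⟩
  · exact ⟨hb, Or.inr hab.symm⟩

theorem chooseI_three {b c : V} (ha : Free s a) (hb : Free s b) (hc : Free s c)
    (hab : G.Adj b a) (hac : G.Adj c a) (hbc : b ≠ c) :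
    freeCard (recolour G s a chooseI) + 3 ≤ freeCard s := by
  classical
  rw [← Finset.card_eq_three.mpr ⟨a, b, c, hab.ne.symm, hac.ne.symm, hbc, rfl⟩]
  refine freeCard_chooseI fun u hu => ?_
  simp only [Finset.mem_insert, Finset.mem_singleton] at hu
  rcases hu with rfl | rfl | rfl
  · exact ⟨ha, Or.inl rfl⟩
  · exact ⟨hb, Or.inr hab⟩
  · exact ⟨hc, Or.inr hac⟩

theorem chooseC_three {x y : V} (hx : Linked G s a x)
    (hy : Free s y) (hxy : y = x ∨ G.Adj y x ∨ Linked G s a y) (hya : y ≠ a) (hyx : y ≠ x) :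
    freeCard (recolour G s a chooseC) + 3 ≤ freeCard s := by
  classical
  rw [← Finset.card_eq_three.mpr ⟨a, x, y, hx.ne, hya.symm, hyx.symm, rfl⟩]
  refine freeCard_chooseC fun u hu => ?_
  simp only [Finset.mem_insert, Finset.mem_singleton] at hu
  rcases hu with rfl | rfl | rfl
  · exact ⟨hx.1, Or.inl rfl⟩
  · exact ⟨hx.2.1, Or.inr (Or.inl hx)⟩
  · refine ⟨hy, Or.inr ?_⟩
    rcases hxy with h | h | h
    · exact absurd h hyx
    · exact Or.inr ⟨x, hx, h⟩
    · exact Or.inl h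

theorem chooseC_four {x₁ x₂ y : V} (h₁ : Linked G s a x₁) (h₂ : Linked G s a x₂) (hne : x₁ ≠ x₂)
    (hy : Free s y) (hxy : G.Adj y x₁ ∨ G.Adj y x₂) (hya : y ≠ a) (hy₁ : y ≠ x₁) (hy₂ : y ≠ x₂) :
    freeCard (recolour G s a chooseC) + 4 ≤ freeCard s := by
  classical
  have hcard : ({a, x₁, x₂, y} : Finset V).card = 4 := by
    rw [Finset.card_insert_of_notMem (by simp [h₁.ne, h₂.ne, hya.symm]),
      Finset.card_eq_three.mpr ⟨x₁, x₂, y, hne, hy₁.symm, hy₂.symm, rfl⟩]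
  rw [← hcard]
  refine freeCard_chooseC fun u hu => ?_
  simp only [Finset.mem_insert, Finset.mem_singleton] at hu
  rcases hu with rfl | rfl | rfl | rfl
  · exact ⟨h₁.1, Or.inl rfl⟩
  · exact ⟨h₁.2.1, Or.inr (Or.inl h₁)⟩
  · exact ⟨h₂.2.1, Or.inr (Or.inl h₂)⟩
  · exact ⟨hy, Or.inr (Or.inr (hxy.elim (fun h => ⟨_, h₁, h⟩) fun h => ⟨_, h₂, h⟩))⟩

end Weight

/-! ### Analysis of one step -/

section StepAnalysis

variable {V : Type*} {G : SimpleGraph V} {s : V → ℕ} {a : V}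

/-- If neither `edgeRule`, `isolatedRule`, `pairRule`, `twoPartnersRule` nor `linkedRule` applies,
then no two vertices are linked. -/
theorem not_linked (h1 : ¬ ∃ a, edgeRule.Applies G s a)
    (h3 : ¬ ∃ a, isolatedRule.Applies G s a) (h6 : ¬ ∃ a, pairRule.Applies G s a)
    (h7 : ¬ ∃ a, twoPartnersRule.Applies G s a) (h9 : ¬ ∃ a, linkedRule.Applies G s a)
    (a x : V) : ¬ Linked G s a x := by
  intro hl
  simp only [applies_pairRule, applies_twoPartnersRule, applies_linkedRule] at h6 h7 h9
  have hax : ∀ y, G.Adj y x ∧ Free s y → y = a := fun y hy => by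
    by_contra hya
    exact h9 ⟨a, x, hl, y, ⟨hy.2, hy.1⟩, hya⟩
  have hxa : ∀ y, G.Adj y a ∧ Free s y → y = x := fun y hy => by
    by_contra hyx
    exact h9 ⟨x, a, hl.symm, y, ⟨hy.2, hy.1⟩, hyx⟩
  obtain ⟨b, hab, hb⟩ := exists_free_neighbour h1 h3 hl.1
  obtain rfl := hxa b ⟨hab.symm, hb⟩
  refine h6 ⟨a, b, ⟨hab, hl⟩, fun w => ⟨⟨hxa w, hax w⟩, fun hw => ?_, fun hw => ?_⟩⟩
  · by_contra hne
    exact h7 ⟨a, w, b, hne, hw, hl⟩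
  · by_contra hne
    exact h7 ⟨b, w, a, hne, hw, hl.symm⟩

/-- In a colouring to which only `freeRule` applies, putting any undecided vertex into the cluster
part creates linked pairs with enough structure for an early rule. -/
theorem early_putC (h1 : ¬ ∃ a, edgeRule.Applies G s a)
    (h3 : ¬ ∃ a, isolatedRule.Applies G s a) (h10 : ¬ ∃ a, cliqueRule.Applies G s a)
    (h11 : ¬ ∃ a, leafRule.Applies G s a) (v : V) (hv : Free s v) :
    Early G (recolour G s v putC) := by
  classical
  simp only [applies_leafRule, applies_cliqueRule, not_exists, not_and] at h10 h11
  -- every undecided vertex has two undecided neighbours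
  have two : ∀ u w, Free s u → ∃ b, G.Adj u b ∧ Free s b ∧ b ≠ w := by
    intro u w hu
    by_contra hc
    push Not at hc
    obtain ⟨b, hub, hb⟩ := exists_free_neighbour h1 h3 hu
    obtain rfl := hc b hub hb
    exact h11 b hb u ⟨⟨hu, hub⟩, fun x hx => hc x hx.1 hx.2⟩
  set s' := recolour G s v putC with hs'
  have hf : ∀ u, Free s u → u ≠ v → Free s' u := fun u hu huv =>
    free_recolour_putC.mpr ⟨hu, huv⟩
  have hv' : s' v = 1 := by rw [hs', recolour_putC, if_pos rfl]
  have hlink : ∀ p q, Free s p → Free s q → p ≠ v → q ≠ v → IsP3 G p q v → Linked G s' p q :=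
    fun p q hp hq hpv hqv h => ⟨hf p hp hpv, hf q hq hqv, v, hv', h⟩
  have R2 : ∀ b x y, Free s b → b ≠ v → Linked G s' x y → G.Adj b x → G.Adj b y → Early G s' :=
    fun b x y hb hbv hl hx hy => ⟨commonNeighbourRule, by simp [earlyRules], b,
      applies_commonNeighbourRule.mpr ⟨hf b hb hbv, x, y, hl, hx, hy⟩⟩
  have R5 : ∀ p q r, Linked G s' p q → Linked G s' p r → q ≠ r → Early G s' :=
    fun p q r h₁ h₂ hne => ⟨twoPartnersRule, by simp [earlyRules], p,
      applies_twoPartnersRule.mpr ⟨q, r, hne, h₁, h₂⟩⟩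
  -- the case of an undecided vertex at distance two
  have far : ∀ p q, Free s p → Free s q → G.Adj v p → G.Adj p q → ¬ G.Adj v q → v ≠ q →
      Early G s' := by
    intro p q hp hq hvp hpq hvq hne
    have hl : Linked G s' p q := hlink p q hp hq hvp.ne.symm hne.symm
      (Or.inr (Or.inl ⟨hpq, hvp.symm, fun h => hvq h.symm, hne.symm⟩))
    obtain ⟨r, hvr, hr, hrp⟩ := two v p hv
    by_cases hpr : G.Adj p r
    · obtain ⟨y, hqy, hy, hyp⟩ := two q p hq
      have hyv : y ≠ v := fun h => hvq (h ▸ hqy.symm)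
      refine ⟨adjacentPairRule, by simp [earlyRules], p, applies_adjacentPairRule.mpr
        ⟨q, ⟨hpq, hl⟩, ⟨r, ⟨hf r hr hvr.ne.symm, hpr.symm⟩, fun h => hvq (h ▸ hvr)⟩,
          y, ⟨hf y hy hyv, hqy.symm⟩, hyp⟩⟩
    · exact R5 p q r hl (hlink p r hp hr hvp.ne.symm hvr.ne.symm
        (Or.inr (Or.inr ⟨hvp.symm, hvr.symm, hpr, hrp.symm⟩))) fun h => hvq (h ▸ hvr)
  have h10' := h10 v hv
  push Not at h10'
  obtain ⟨p, q, ⟨hp, hq⟩, hP⟩ := h10'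
  rcases hP with ⟨h₁, h₂, h₃, h₄⟩ | ⟨h₁, h₂, h₃, h₄⟩ | ⟨h₁, h₂, h₃, h₄⟩
  · exact far p q hp hq h₁ h₂ h₃ h₄
  · have hpq : Linked G s' p q := hlink p q hp hq h₁.ne.symm h₂.ne.symm
      (Or.inr (Or.inr ⟨h₁.symm, h₂.symm, h₃, h₄⟩))
    obtain ⟨b, hpb, hb, hbv⟩ := two p v hp
    by_cases hvb : G.Adj v b
    · by_cases hbq : G.Adj b q
      · exact R2 b p q hb hbv hpq hpb.symm hbq
      · have hbq' : b ≠ q := fun h => h₃ (h ▸ hpb)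
        exact R5 q b p (hlink q b hq hb h₂.ne.symm hbv
          (Or.inr (Or.inr ⟨h₂.symm, hvb.symm, fun h => hbq h.symm, hbq'.symm⟩))) hpq.symm
          hpb.ne.symm
    · exact far p b hp hb h₁ hpb hvb hbv.symm
  · exact far q p hq hp h₁ h₂.symm h₃ h₄

theorem early_of_mem {r : Rule} (hr : r ∈ earlyRules) (ha : r.Applies G s a) : Early G s :=
  ⟨r, hr, a, ha⟩

theorem not_early (h : ∀ r ∈ earlyRules, ¬ ∃ a, r.Applies G s a) : ¬ Early G s :=
  fun ⟨r, hr, ha⟩ => h r hr ha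

/-- If no rule applies, then the colouring is a monopolar partition. -/
theorem Step.none (h : Step G s rules none) :
    IsMonopolarPartition G {v | s v = 1} {v | s v = 0} := by
  simp only [rules, earlyRules, List.cons_append, List.nil_append, Step, reduceCtorEq,
    and_false, exists_false, false_or, and_true] at h
  obtain ⟨h0, -, -, -, -, -, -, -, -, -, -, -, h12⟩ := h
  simp only [applies_freeRule, not_exists] at h12
  simp only [applies_violationRule, not_exists] at h0
  have hcol : ∀ u, s u = 1 ∨ s u = 0 := fun u => (not_free_cases u).resolve_left (h12 u)
  rw [isMonopolarPartition_iff]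
  refine ⟨?_, fun u v huv => ?_, fun x hx y hy z hz hP => ?_⟩
  · ext u
    have := hcol u
    simp only [Set.mem_ofPred_eq, Set.mem_compl_iff]
    omega
  · by_contra hc
    simp only [Set.mem_ofPred_eq, not_or] at hc
    exact h0 u (Or.inl ⟨(hcol u).resolve_left hc.1, v, (hcol v).resolve_left hc.2, huv⟩)
  · exact h0 x (Or.inr ⟨hx, y, hy, z, hz, hP⟩)

variable [Fintype V]

theorem weight_twoPartnersRule (h1 : ¬ ∃ a, edgeRule.Applies G s a)
    (h3 : ¬ ∃ a, isolatedRule.Applies G s a) (h5 : ¬ ∃ a, adjacentPartnersRule.Applies G s a)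
    (h : twoPartnersRule.Applies G s a) :
    1 + (weight G (recolour G s a chooseI) + weight G (recolour G s a chooseC)) ≤ weight G s := by
  have hX := one_le_pow_freeCard (s := s)
  rw [weight_eq_early (early_of_mem (by simp [earlyRules]) h)]
  rw [applies_twoPartnersRule] at h
  obtain ⟨x, y, hxy, hx, hy⟩ := h
  have hnadj : ¬ G.Adj x y := fun hadj =>
    h5 ⟨a, applies_adjacentPartnersRule.mpr ⟨hx.1, x, y, ⟨hx, hy⟩, hadj⟩⟩
  by_cases hc : ∃ w, Free s w ∧ (G.Adj w x ∨ G.Adj w y) ∧ w ≠ a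
  · obtain ⟨w, hw, hw', hwa⟩ := hc
    have hwx : w ≠ x := by
      rintro rfl
      exact hw'.elim (fun h => G.irrefl h) hnadj
    have hwy : w ≠ y := by
      rintro rfl
      exact hw'.elim (fun h => hnadj h.symm) (fun h => G.irrefl h)
    have := weight_le_two (G := G) (chooseI_two h1 h3 hx.1)
    have := weight_le_four (G := G) (chooseC_four hx hy hxy hw hw' hwa hwx hwy)
    linarith
  · push Not at hc
    obtain ⟨b, hxb, hb⟩ := exists_free_neighbour h1 h3 hx.2.1
    obtain rfl := hc b hb (Or.inl hxb.symm)
    obtain ⟨c, hyc, hc'⟩ := exists_free_neighbour h1 h3 hy.2.1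
    obtain rfl := hc c hc' (Or.inr hyc.symm)
    have := weight_le_three (G := G) (chooseI_three hb hx.2.1 hy.2.1 hxb hyc hxy)
    have := weight_le_three (G := G) (chooseC_three hx hy.2.1 (Or.inr (Or.inr hy))
      hy.ne.symm hxy.symm)
    linarith

theorem weight_adjacentPairRule (h : adjacentPairRule.Applies G s a) :
    1 + (weight G (recolour G s a chooseI) + weight G (recolour G s a chooseC)) ≤ weight G s := by
  have hX := one_le_pow_freeCard (s := s)
  rw [weight_eq_early (early_of_mem (by simp [earlyRules]) h)]
  rw [applies_adjacentPairRule] at h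
  obtain ⟨x, ⟨hax, hx⟩, ⟨b, ⟨hb, hba⟩, hbx⟩, y, ⟨hy, hyx⟩, hya⟩ := h
  have := weight_le_three (G := G) (chooseI_three hx.1 hb hx.2.1 hba hax.symm hbx)
  have := weight_le_three (G := G) (chooseC_three hx hy (Or.inr (Or.inl hyx)) hya hyx.ne)
  linarith

theorem weight_linkedRule (he : ¬ Early G s) (h1 : ¬ ∃ a, edgeRule.Applies G s a)
    (h3 : ¬ ∃ a, isolatedRule.Applies G s a) (h : linkedRule.Applies G s a) :
    1 + (weight G (recolour G s a chooseI) + weight G (recolour G s a chooseC)) ≤ weight G s := by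
  have hX := one_le_pow_freeCard (s := s)
  rw [weight_eq_late he]
  rw [applies_linkedRule] at h
  obtain ⟨x, hx, y, ⟨hy, hyx⟩, hya⟩ := h
  have := weight_le_two (G := G) (chooseI_two h1 h3 hx.1)
  have := weight_le_three (G := G) (chooseC_three hx hy (Or.inr (Or.inl hyx)) hya hyx.ne)
  linarith

theorem weight_leafRule (he : ¬ Early G s) (h10 : ¬ ∃ a, cliqueRule.Applies G s a)
    (h : leafRule.Applies G s a) :
    1 + (weight G (recolour G s a chooseI) + weight G (recolour G s a chooseLeaves)) ≤
      weight G s := by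
  have hX := one_le_pow_freeCard (s := s)
  rw [weight_eq_late he]
  rw [applies_leafRule] at h
  obtain ⟨ha, v, hv⟩ := h
  -- otherwise `a` and `v` would form a component of the undecided part
  obtain ⟨w, hw, hwa, hwv⟩ : ∃ w, Free s w ∧ G.Adj w a ∧ w ≠ v := by
    by_contra hc
    push Not at hc
    refine h10 ⟨v, applies_cliqueRule.mpr ⟨hv.1.1, fun p q hpq hP => ?_⟩⟩
    rcases hP with ⟨h₁, h₂, _, h₄⟩ | ⟨h₁, h₂, _, h₄⟩ | ⟨h₁, h₂, _, h₄⟩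
    · obtain rfl := hv.2 p ⟨h₁, hpq.1⟩
      exact h₄ (hc q hpq.2 h₂.symm).symm
    · exact h₄ ((hv.2 p ⟨h₁, hpq.1⟩).trans (hv.2 q ⟨h₂, hpq.2⟩).symm)
    · obtain rfl := hv.2 q ⟨h₁, hpq.2⟩
      exact h₄ (hc p hpq.1 h₂).symm
  have := weight_le_three (G := G) (chooseI_three ha hv.1.1 hw hv.1.2 hwa hwv.symm)
  have := weight_le_two (G := G) (freeCard_chooseLeaves ha hv)
  linarith

theorem weight_freeRule (he : ¬ Early G s) (h1 : ¬ ∃ a, edgeRule.Applies G s a)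
    (h3 : ¬ ∃ a, isolatedRule.Applies G s a) (h10 : ¬ ∃ a, cliqueRule.Applies G s a)
    (h11 : ¬ ∃ a, leafRule.Applies G s a) (hl : ∀ x y, ¬ Linked G s x y)
    (h : freeRule.Applies G s a) :
    1 + (weight G (recolour G s a chooseI) + weight G (recolour G s a chooseC)) ≤ weight G s := by
  have hX := one_le_pow_freeCard (s := s)
  rw [weight_eq_late he, recolour_chooseC_of_not_linked hl]
  rw [applies_freeRule] at h
  have := weight_le_early (freeCard_putC h) (early_putC h1 h3 h10 h11 a h)
  obtain ⟨b, hab, hb⟩ := exists_free_neighbour h1 h3 h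
  obtain ⟨c, hc, hac, hcb⟩ : ∃ c, Free s c ∧ G.Adj a c ∧ c ≠ b := by
    by_contra hc
    push Not at hc
    exact h11 ⟨b, applies_leafRule.mpr ⟨hb, a, ⟨h, hab⟩, fun w hw => hc w hw.2 hw.1⟩⟩
  have := weight_le_three (G := G) (chooseI_three h hb hc hab.symm hac.symm hcb.symm)
  linarith

theorem weight_single_early {s' : V → ℕ} (he : Early G s) (h : freeCard s' + 1 ≤ freeCard s) :
    1 + weight G s' ≤ weight G s := by
  have hX := one_le_pow_freeCard (s := s)
  rw [weight_eq_early he]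
  have := weight_le_one (G := G) h
  linarith

/-- A step keeps solvability and decreases the weight. -/
theorem Step.some {L : List (V → ℕ)} (h : Step G s rules (some L)) :
    (Solvable G s → ∃ s' ∈ L, Solvable G s') ∧ 1 + (L.map (weight G)).sum ≤ weight G s := by
  simp only [rules, earlyRules, List.cons_append, List.nil_append, Step, reduceCtorEq,
    and_false, or_false, Option.some.injEq] at h
  have hX := one_le_pow_freeCard (s := s)
  rcases h with ⟨a, ha, rfl⟩ | ⟨h0, h⟩
  · constructor
    · rintro ⟨C, hC, hs⟩
      rw [applies_violationRule] at ha
      rcases ha with ⟨ha, b, hb, hab⟩ | ⟨ha, b, hb, c, hc, hP⟩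
      · exact ((hC.1 a b hab).elim ((hs a).2 ha) ((hs b).2 hb)).elim
      · exact (hC.2 a ((hs a).1 ha) b ((hs b).1 hb) c ((hs c).1 hc) hP).elim
    · rw [weight_eq_early (early_of_mem (by simp [earlyRules]) ha)]
      simp only [violationRule, List.map_nil, List.sum_nil]
      linarith
  rcases h with ⟨a, ha, rfl⟩ | ⟨h1, h⟩
  · simp only [edgeRule, List.map_cons, List.map_nil, List.sum_cons, List.sum_nil, add_zero]
    exact ⟨fun h => ⟨_, by simp, solvable_edgeRule ha h⟩,
      weight_single_early (early_of_mem (by simp [earlyRules]) ha)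
        (freeCard_putC (applies_edgeRule.mp ha).1)⟩
  rcases h with ⟨a, ha, rfl⟩ | ⟨h2, h⟩
  · simp only [pathRule, List.map_cons, List.map_nil, List.sum_cons, List.sum_nil, add_zero]
    exact ⟨fun h => ⟨_, by simp, solvable_pathRule ha h⟩,
      weight_single_early (early_of_mem (by simp [earlyRules]) ha)
        (freeCard_putI (applies_pathRule.mp ha).1)⟩
  rcases h with ⟨a, ha, rfl⟩ | ⟨h3, h⟩
  · simp only [isolatedRule, List.map_cons, List.map_nil, List.sum_cons, List.sum_nil, add_zero]
    exact ⟨fun h => ⟨_, by simp, solvable_isolatedRule ha h⟩,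
      weight_single_early (early_of_mem (by simp [earlyRules]) ha)
        (freeCard_putI (applies_isolatedRule.mp ha).1)⟩
  rcases h with ⟨a, ha, rfl⟩ | ⟨h4, h⟩
  · simp only [commonNeighbourRule, List.map_cons, List.map_nil, List.sum_cons, List.sum_nil,
      add_zero]
    exact ⟨fun h => ⟨_, by simp, solvable_commonNeighbourRule ha h⟩,
      weight_single_early (early_of_mem (by simp [earlyRules]) ha)
        (freeCard_putC (applies_commonNeighbourRule.mp ha).1)⟩
  rcases h with ⟨a, ha, rfl⟩ | ⟨h5, h⟩
  · simp only [adjacentPartnersRule, List.map_cons, List.map_nil, List.sum_cons, List.sum_nil,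
      add_zero]
    exact ⟨fun h => ⟨_, by simp, solvable_adjacentPartnersRule ha h⟩,
      weight_single_early (early_of_mem (by simp [earlyRules]) ha)
        (freeCard_putI (applies_adjacentPartnersRule.mp ha).1)⟩
  rcases h with ⟨a, ha, rfl⟩ | ⟨h6, h⟩
  · simp only [pairRule, List.map_cons, List.map_nil, List.sum_cons, List.sum_nil, add_zero]
    obtain ⟨x, hx, -⟩ := applies_pairRule.mp ha
    exact ⟨fun h => ⟨_, by simp, solvable_pairRule h1 h2 ha h⟩,
      weight_single_early (early_of_mem (by simp [earlyRules]) ha) (freeCard_putI hx.2.1)⟩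
  rcases h with ⟨a, ha, rfl⟩ | ⟨h7, h⟩
  · refine ⟨fun h => solvable_branch h, ?_⟩
    simpa [twoPartnersRule] using weight_twoPartnersRule h1 h3 h5 ha
  rcases h with ⟨a, ha, rfl⟩ | ⟨h8, h⟩
  · refine ⟨fun h => solvable_branch h, ?_⟩
    simpa [adjacentPairRule] using weight_adjacentPairRule ha
  have he : ¬ Early G s := not_early (by
    simp only [earlyRules, List.mem_cons, List.not_mem_nil, or_false, forall_eq_or_imp, forall_eq]
    exact ⟨h0, h1, h2, h3, h4, h5, h6, h7, h8⟩)
  rcases h with ⟨a, ha, rfl⟩ | ⟨h9, h⟩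
  · refine ⟨fun h => solvable_branch h, ?_⟩
    simpa [linkedRule] using weight_linkedRule he h1 h3 ha
  have hl := not_linked h1 h3 h6 h7 h9
  rcases h with ⟨a, ha, rfl⟩ | ⟨h10, h⟩
  · simp only [cliqueRule, List.map_cons, List.map_nil, List.sum_cons, List.sum_nil, add_zero]
    refine ⟨fun h => ⟨_, by simp, solvable_cliqueRule h2 hl ha h⟩, ?_⟩
    rw [weight_eq_late he]
    have := weight_le_one (G := G) (freeCard_putC (G := G) (applies_cliqueRule.mp ha).1)
    linarith
  rcases h with ⟨a, ha, rfl⟩ | ⟨h11, a, ha, rfl⟩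
  · refine ⟨fun h => solvable_leafRule h1 ha h, ?_⟩
    simpa [leafRule] using weight_leafRule he h10 ha
  · refine ⟨fun h => solvable_branch h, ?_⟩
    simpa [freeRule] using weight_freeRule he h1 h3 h10 h11 hl ha

end StepAnalysis

/-! ### Reasoning about programs -/

section Programs

/-- The program `P`, started in the store `s`, halts after at most `T` steps in a store that
satisfies `Q`. -/
def Does (P : Prog) (s : Store) (T : ℕ) (Q : Store → Prop) : Prop :=
  ∃ t s', Runs P s t s' ∧ t ≤ T ∧ Q s'

variable {P P' : Prog} {s : Store} {T T' : ℕ} {Q Q' : Store → Prop}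

@[simp] theorem setVar_var (s : Store) (x v y : ℕ) :
    (s.setVar x v).var y = if y = x then v else s.var y := by
  simp [Store.setVar, Function.update_apply]

@[simp] theorem setVar_arr (s : Store) (x v : ℕ) : (s.setVar x v).arr = s.arr := rfl

@[simp] theorem setArr_var (s : Store) (a i v : ℕ) : (s.setArr a i v).var = s.var := rfl

@[simp] theorem setArr_arr (s : Store) (a i v b j : ℕ) :
    (s.setArr a i v).arr b j = if b = a ∧ j = i then v else s.arr b j := by
  simp only [Store.setArr, Function.update_apply]
  grind

theorem Does.mono (h : Does P s T Q) (hT : T ≤ T') (hQ : ∀ s', Q s' → Q' s') :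
    Does P s T' Q' := by
  obtain ⟨t, s', h1, h2, h3⟩ := h
  exact ⟨t, s', h1, h2.trans hT, hQ _ h3⟩

theorem Does.seq {R : Store → Prop} (h : Does P s T Q) (h' : ∀ s', Q s' → Does P' s' T' R) :
    Does (.seq P P') s (T + T') R := by
  obtain ⟨t, s', h1, h2, h3⟩ := h
  obtain ⟨t', s'', h1', h2', h3'⟩ := h' s' h3
  exact ⟨t + t', s'', .seq h1 h1', by omega, h3'⟩

theorem Does.skip (h : Q s) : Does .skip s 1 Q := ⟨1, s, .skip s, le_rfl, h⟩

theorem Does.const {x c : ℕ} (h : Q (s.setVar x c)) : Does (.const x c) s 1 Q :=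
  ⟨1, _, .const x c s, le_rfl, h⟩

theorem Does.copy {x y : ℕ} (h : Q (s.setVar x (s.var y))) : Does (.copy x y) s 1 Q :=
  ⟨1, _, .copy x y s, le_rfl, h⟩

theorem Does.incr {x : ℕ} (h : Q (s.setVar x (s.var x + 1))) : Does (.incr x) s 1 Q :=
  ⟨1, _, .incr x s, le_rfl, h⟩

theorem Does.decr {x : ℕ} (h : Q (s.setVar x (s.var x - 1))) : Does (.decr x) s 1 Q :=
  ⟨1, _, .decr x s, le_rfl, h⟩

theorem Does.load {x a i : ℕ} (h : Q (s.setVar x (s.arr a (s.var i)))) :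
    Does (.load x a i) s 1 Q :=
  ⟨1, _, .load x a i s, le_rfl, h⟩

theorem Does.store {a i x : ℕ} (h : Q (s.setArr a (s.var i) (s.var x))) :
    Does (.store a i x) s 1 Q :=
  ⟨1, _, .store a i x s, le_rfl, h⟩

theorem Does.ifLt {x y : ℕ} (h : s.var x < s.var y → Does P s T Q)
    (h' : ¬ s.var x < s.var y → Does P' s T Q) : Does (.ifLt x y P P') s (T + 1) Q := by
  by_cases hc : s.var x < s.var y
  · obtain ⟨t, s', h1, h2, h3⟩ := h hc
    exact ⟨t + 1, s', .ifTrue hc h1, by omega, h3⟩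
  · obtain ⟨t, s', h1, h2, h3⟩ := h' hc
    exact ⟨t + 1, s', .ifFalse hc h1, by omega, h3⟩

/-- `for i = 0, …, m - 1 do P`, for variables `i` and `m`. -/
def forLoop (i m : ℕ) (P : Prog) : Prog :=
  .seq (.const i 0) (.whileLt i m (.seq P (.incr i)))

theorem Does.forLoop {i m N : ℕ} {Inv : ℕ → Store → Prop} (hm : s.var m = N) (him : m ≠ i)
    (h0 : Inv 0 (s.setVar i 0))
    (hstep : ∀ k s', k < N → Inv k s' → s'.var i = k → s'.var m = N →
      Does P s' T fun s'' => s''.var i = k ∧ s''.var m = N ∧ Inv (k + 1) (s''.setVar i (k + 1))) :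
    Does (forLoop i m P) s (N * (T + 2) + 2) (Inv N) := by
  have key : ∀ r k s', k + r = N → Inv k s' → s'.var i = k → s'.var m = N →
      Does (.whileLt i m (.seq P (.incr i))) s' (r * (T + 2) + 1) (Inv N) := by
    intro r
    induction r with
    | zero =>
      intro k s' hk hI hi hm'
      obtain rfl : k = N := by omega
      exact ⟨1, s', .whileFalse (by omega), by omega, hI⟩
    | succ r ih =>
      intro k s' hk hI hi hm'
      obtain ⟨t, s'', h1, h2, h3, h4, h5⟩ := hstep k s' (by omega) hI hi hm'
      obtain ⟨t', s3, h1', h2', h3'⟩ := ih (k + 1) (s''.setVar i (k + 1)) (by omega) h5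
        (by simp) (by simp [him, h4])
      refine ⟨(t + 1) + t' + 1, s3, .whileTrue (by omega)
        (.seq h1 (.incr i s'')) (by rw [h3]; exact h1'), ?_, h3'⟩
      rw [Nat.succ_mul]
      omega
  refine (Does.seq (Does.const (Q := fun s' => s' = s.setVar i 0) rfl)
    (T' := N * (T + 2) + 1) ?_).mono (by omega) fun _ h => h
  rintro s' rfl
  exact key N 0 _ (by omega) h0 (by simp) (by simp [him, hm])

end Programs

/-! ### Evaluation of formulas -/

section Evaluation

open Polynomial

/-- The part of the store that describes the input graph `G`: variables `0`, `1`, `9` hold the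
number of vertices and the constants one and zero, and array `0` the adjacency matrix. -/
structure HoldsGraph {n : ℕ} (G : SimpleGraph (Fin n)) (s : Store) : Prop where
  size : s.var 0 = n
  one : s.var 1 = 1
  zero : s.var 9 = 0
  adj : ∀ i j : Fin n, (G.Adj i j → s.arr 0 (i * n + j) = 1) ∧
    (¬ G.Adj i j → s.arr 0 (i * n + j) = 0)

/-- Array `1` of the store holds the colouring `c`. -/
def HoldsColouring {n : ℕ} (c : Fin n → ℕ) (s : Store) : Prop := ∀ i : Fin n, s.arr 1 i = c i

/-- The stores `s` and `s'` agree on the arrays and on all variables outside `Y`. -/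
def AgreeOff (Y : Set ℕ) (s s' : Store) : Prop := s'.arr = s.arr ∧ ∀ y ∉ Y, s'.var y = s.var y

/-- The variables that the evaluation of a formula at depth `d` may change. -/
def scratch (d : ℕ) : Set ℕ := {y | (2 ≤ y ∧ y ≤ 5) ∨ 20 + d ≤ y}

/-- The variables `20`, `21`, … hold the values of the variables of a formula at depth `d`. -/
def HoldsEnv {n : ℕ} (d : ℕ) (ρ : ℕ → Fin n) (s : Store) : Prop :=
  ∀ i < d, s.var (20 + i) = ρ i

theorem mem_scratch {d y : ℕ} : y ∈ scratch d ↔ (2 ≤ y ∧ y ≤ 5) ∨ 20 + d ≤ y := Iff.rfl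

theorem AgreeOff.refl (Y : Set ℕ) (s : Store) : AgreeOff Y s s := ⟨rfl, fun _ _ => rfl⟩

theorem AgreeOff.trans {Y : Set ℕ} {s s' s'' : Store} (h : AgreeOff Y s s')
    (h' : AgreeOff Y s' s'') : AgreeOff Y s s'' :=
  ⟨h'.1.trans h.1, fun y hy => (h'.2 y hy).trans (h.2 y hy)⟩

theorem AgreeOff.mono {Y Z : Set ℕ} {s s' : Store} (h : AgreeOff Y s s') (hXY : Y ⊆ Z) :
    AgreeOff Z s s' := ⟨h.1, fun y hy => h.2 y fun hx => hy (hXY hx)⟩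

theorem AgreeOff.setVar {Y : Set ℕ} {s s' : Store} (h : AgreeOff Y s s') {x v : ℕ} (hx : x ∈ Y) :
    AgreeOff Y s (s'.setVar x v) :=
  ⟨h.1, fun y hy => by
    have : y ≠ x := fun e => hy (e ▸ hx)
    simp [this, h.2 y hy]⟩

variable {n : ℕ} {G : SimpleGraph (Fin n)} {c : Fin n → ℕ} {s s' : Store} {d : ℕ} {ρ : ℕ → Fin n}
  {Y : Set ℕ}

theorem HoldsGraph.agree (h : HoldsGraph G s) (ha : AgreeOff Y s s') (h0 : 0 ∉ Y) (h1 : 1 ∉ Y)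
    (h9 : 9 ∉ Y) : HoldsGraph G s' where
  size := by rw [ha.2 0 h0, h.size]
  one := by rw [ha.2 1 h1, h.one]
  zero := by rw [ha.2 9 h9, h.zero]
  adj := by rw [ha.1]; exact h.adj

theorem HoldsGraph.agree_scratch (h : HoldsGraph G s) (ha : AgreeOff (scratch d) s s') :
    HoldsGraph G s' :=
  h.agree ha (by simp [mem_scratch]) (by rw [mem_scratch]; omega) (by rw [mem_scratch]; omega)

theorem HoldsColouring.agree (h : HoldsColouring c s) (ha : AgreeOff Y s s') :
    HoldsColouring c s' := by
  intro i
  rw [ha.1]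
  exact h i

theorem HoldsEnv.agree (h : HoldsEnv d ρ s) (ha : AgreeOff (scratch d) s s') :
    HoldsEnv d ρ s' := fun i hi => by
  rw [ha.2 _ (by rw [mem_scratch]; omega), h i hi]

theorem scratch_mono : scratch (d + 1) ⊆ scratch d := fun y hy => by
  rw [mem_scratch] at *; omega

/-- Compare variables `x` and `y`; the answer goes to variable `2`. -/
def compareProg (x y : ℕ) : Prog :=
  .ifLt x y (.const 2 0) (.ifLt y x (.const 2 0) (.const 2 1))

/-- A program that evaluates a formula at depth `d`. The answer (`1` for true, `0` for false) goes
to variable `2`. -/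
def evalProg : Formula → ℕ → Prog
  | .isC i, _ => .seq (.load 3 1 (20 + i)) (.seq (.const 4 1) (compareProg 3 4))
  | .isI i, _ => .seq (.load 3 1 (20 + i)) (.seq (.const 4 0) (compareProg 3 4))
  | .adj i j, _ => .seq (.copy 3 (20 + j))
      (.seq (forLoop 4 (20 + i) (forLoop 5 0 (.incr 3))) (.load 2 0 3))
  | .eq i j, _ => compareProg (20 + i) (20 + j)
  | .neg φ, d => .seq (evalProg φ d) (.ifLt 2 1 (.const 2 1) (.const 2 0))
  | .conj φ ψ, d => .seq (evalProg φ d) (.ifLt 2 1 .skip (evalProg ψ d))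
  | .ex φ, d => .seq (.const 2 0) (forLoop (20 + d) 0 (.ifLt 2 1 (evalProg φ (d + 1)) .skip))

/-- A bound for the running time of `evalProg`, as a polynomial in the number of vertices. -/
noncomputable def evalCost : Formula → ℕ[X]
  | .isC _ => 5
  | .isI _ => 5
  | .adj _ _ => X * (X * 3 + 4) + 4
  | .eq _ _ => 3
  | .neg φ => evalCost φ + 2
  | .conj φ ψ => evalCost φ + evalCost ψ + 2
  | .ex φ => X * (evalCost φ + 4) + 3

open Classical in
/-- The outcome of an evaluation: variable `2` holds the truth value of `p`, and no variable outside
the scratch space has changed. -/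
def Evaluates (d : ℕ) (s : Store) (p : Prop) (s' : Store) : Prop :=
  AgreeOff (scratch d) s s' ∧ s'.var 2 = if p then 1 else 0

theorem does_compareProg {s₀ : Store} (hs : AgreeOff (scratch d) s₀ s) {x y : ℕ} :
    Does (compareProg x y) s 3 (Evaluates d s₀ (s.var x = s.var y)) := by
  have h2 : (2 : ℕ) ∈ scratch d := by simp [mem_scratch]
  refine Does.ifLt (fun h => ?_) (fun h => Does.ifLt (fun h' => ?_) fun h' => ?_)
  · exact (Does.const ⟨hs.setVar h2, by simp [h.ne]⟩).mono (by omega) fun _ h => h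
  · exact Does.const ⟨hs.setVar h2, by simp [h'.ne']⟩
  · exact Does.const ⟨hs.setVar h2, by simp [le_antisymm (not_lt.mp h') (not_lt.mp h)]⟩

theorem Evaluates.congr {s₀ : Store} {p q : Prop} (h : Evaluates d s₀ p s) (hpq : p ↔ q) :
    Evaluates d s₀ q s := by
  rwa [propext hpq] at h

theorem does_colour (k : ℕ) (hc : HoldsColouring c s) (hρ : HoldsEnv d ρ s) {i : ℕ} (hi : i < d) :
    Does (.seq (.load 3 1 (20 + i)) (.seq (.const 4 k) (compareProg 3 4))) s 5
      (Evaluates d s (c (ρ i) = k)) := by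
  refine Does.seq (T := 1) (T' := 4) (Does.load rfl) fun s₁ h₁ => ?_
  refine Does.seq (T := 1) (T' := 3) (Does.const rfl) fun s₂ h₂ => ?_
  have ha : AgreeOff (scratch d) s s₂ := by
    rw [← h₂, ← h₁]
    exact ((AgreeOff.refl _ s).setVar (by simp [mem_scratch])).setVar (by simp [mem_scratch])
  refine (does_compareProg ha).mono le_rfl fun s' h => h.congr ?_
  have : s₂.var 3 = c (ρ i) := by
    rw [← h₂, ← h₁]; simp [hρ i hi, hc (ρ i)]
  have h4 : s₂.var 4 = k := by rw [← h₂]; simp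
  rw [this, h4]

theorem does_adj (hG : HoldsGraph G s) (hρ : HoldsEnv d ρ s) {i j : ℕ} (hi : i < d) (hj : j < d) :
    Does (evalProg (.adj i j) d) s ((evalCost (.adj i j)).eval n)
      (Evaluates d s (G.Adj (ρ i) (ρ j))) := by
  have hm : ∀ y, 3 ≤ y → y ≤ 5 → y ∈ scratch d := fun y h h' => by rw [mem_scratch]; omega
  -- the index of the matrix entry is computed by repeated increments
  have hloop : Does (forLoop 4 (20 + i) (forLoop 5 0 (.incr 3))) (s.setVar 3 (ρ j))
      ((ρ i : ℕ) * ((n * (1 + 2) + 2) + 2) + 2)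
      (fun s' => AgreeOff (scratch d) s s' ∧ s'.var 3 = ρ i * n + ρ j) := by
    refine Does.forLoop (N := ρ i)
      (Inv := fun k s' => AgreeOff (scratch d) s s' ∧ s'.var 3 = k * n + ρ j)
      (by simp [show 20 + i ≠ 3 by omega, hρ i hi]) (by omega) ⟨?_, by simp⟩ ?_
    · exact ((AgreeOff.refl _ s).setVar (hm 3 (by omega) (by omega))).setVar
        (hm 4 (by omega) (by omega))
    · rintro k s₁ hk ⟨ha, h3⟩ h4 h20
      have h0 : s₁.var 0 = n := by rw [ha.2 0 (by simp [mem_scratch]), hG.size]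
      refine (Does.forLoop (N := n) (Inv := fun l s' => AgreeOff (scratch d) s s' ∧
        s'.var 4 = k ∧ s'.var 3 = k * n + ρ j + l) h0 (by omega)
        ⟨ha.setVar (hm 5 (by omega) (by omega)), by simp [h4], by simp [h3]⟩ ?_).mono le_rfl ?_
      · rintro l s₂ hl ⟨ha₂, h4', h3'⟩ h5 h0'
        refine Does.incr ⟨by simp [h5], by simp [h0'], ?_, by simp [h4'], by simp [h3']; ring⟩
        exact (ha₂.setVar (hm 3 (by omega) (by omega))).setVar (hm 5 (by omega) (by omega))
      · rintro s₂ ⟨ha₂, h4', h3'⟩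
        refine ⟨h4', ?_, ha₂.setVar (hm 4 (by omega) (by omega)), by simp [h3']; ring⟩
        rw [ha₂.2 _ (by rw [mem_scratch]; omega), hρ i hi]
  rw [evalProg]
  refine (Does.seq (T := 1) (Does.copy rfl) fun s₁ h₁ =>
    Does.seq (T := (ρ i : ℕ) * ((n * (1 + 2) + 2) + 2) + 2) (T' := 1)
      (Q := fun s' => AgreeOff (scratch d) s s' ∧ s'.var 3 = ρ i * n + ρ j)
      ?_ fun s₂ h₂ => Does.load ?_).mono ?_ fun _ h => h
  · rw [← h₁, hρ j hj]
    exact hloop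
  · refine ⟨h₂.1.setVar (by simp [mem_scratch]), ?_⟩
    have := hG.adj (ρ i) (ρ j)
    rw [← h₂.1.1] at this
    simp only [setVar_var, if_true, h₂.2]
    split_ifs with h
    · exact this.1 h
    · exact this.2 h
  · have : (ρ i : ℕ) * ((n * (1 + 2) + 2) + 2) ≤ n * (n * 3 + 4) :=
      Nat.mul_le_mul (ρ i).2.le (by omega)
    simp only [evalCost, eval_add, eval_mul, eval_X, eval_ofNat]
    omega

theorem does_evalProg (φ : Formula) : ∀ {d : ℕ} {ρ : ℕ → Fin n} {s : Store},
    φ.WellScoped d → HoldsGraph G s → HoldsColouring c s → HoldsEnv d ρ s →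
    Does (evalProg φ d) s ((evalCost φ).eval n) (Evaluates d s (φ.Holds G c d ρ)) := by
  induction φ with
  | isC i =>
    intro d ρ s hw hG hc hρ
    simpa [evalCost, evalProg] using does_colour 1 hc hρ (by simpa [Formula.WellScoped] using hw)
  | isI i =>
    intro d ρ s hw hG hc hρ
    simpa [evalCost, evalProg] using does_colour 0 hc hρ (by simpa [Formula.WellScoped] using hw)
  | adj i j =>
    intro d ρ s hw hG hc hρ
    simp only [Formula.WellScoped, Bool.and_eq_true, decide_eq_true_eq] at hw
    exact does_adj hG hρ hw.1 hw.2
  | eq i j =>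
    intro d ρ s hw hG hc hρ
    simp only [Formula.WellScoped, Bool.and_eq_true, decide_eq_true_eq] at hw
    simp only [evalCost, eval_ofNat]
    refine (does_compareProg (AgreeOff.refl _ s)).mono le_rfl fun s' h => h.congr ?_
    rw [hρ i hw.1, hρ j hw.2, holds_eq, Fin.ext_iff]
  | neg φ ih =>
    intro d ρ s hw hG hc hρ
    simp only [evalCost, eval_add, eval_ofNat]
    refine (Does.seq (T' := 2) (ih hw hG hc hρ) fun s₁ h₁ => ?_).mono le_rfl fun _ h => h
    have h1 : s₁.var 1 = 1 := (hG.agree_scratch h₁.1).one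
    have h2 : (2 : ℕ) ∈ scratch d := by simp [mem_scratch]
    have h := h₁.2
    refine Does.ifLt (fun hlt => ?_) (fun hlt => ?_) <;> rw [h1, h] at hlt <;>
      refine Does.const ⟨h₁.1.setVar h2, ?_⟩ <;>
      by_cases hφ : φ.Holds G c d ρ <;> simp_all
  | conj φ ψ ihφ ihψ =>
    intro d ρ s hw hG hc hρ
    simp only [Formula.WellScoped, Bool.and_eq_true] at hw
    simp only [evalCost, eval_add, eval_ofNat]
    refine (Does.seq (T' := (evalCost ψ).eval n + 2) (ihφ hw.1 hG hc hρ)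
      fun s₁ h₁ => ?_).mono (by omega) fun _ h => h
    have h1 : s₁.var 1 = 1 := (hG.agree_scratch h₁.1).one
    have h := h₁.2
    refine Does.ifLt (fun hlt => ?_) (fun hlt => ?_)
    · rw [h1, h] at hlt
      have hφ : ¬ φ.Holds G c d ρ := fun hφ => by simp [hφ] at hlt
      refine (Does.skip ⟨h₁.1, ?_⟩).mono (by omega) fun _ h => h
      simp [h, hφ]
    · rw [h1, h] at hlt
      have hφ : φ.Holds G c d ρ := by
        by_contra hφ; simp [hφ] at hlt
      refine (ihψ hw.2 (hG.agree_scratch h₁.1) (hc.agree h₁.1) (hρ.agree h₁.1)).mono (by omega)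
        fun s₂ h₂ => ⟨h₁.1.trans h₂.1, ?_⟩
      exact (h₂.congr ⟨fun h => ⟨hφ, h⟩, fun h => h.2⟩).2
  | ex φ ih =>
    intro d ρ s hw hG hc hρ
    simp only [evalCost, eval_add, eval_mul, eval_X, eval_ofNat]
    have hm : 20 + d ∈ scratch d := by rw [mem_scratch]; omega
    have h2m : (2 : ℕ) ∈ scratch d := by simp [mem_scratch]
    refine (Does.seq (T := 1) (T' := n * (((evalCost φ).eval n + 1 + 1) + 2) + 2) (Does.const rfl)
      fun s₁ h₁ => ?_).mono (by ring_nf; omega) fun _ h => h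
    have ha₁ : AgreeOff (scratch d) s s₁ := by
      rw [← h₁]; exact (AgreeOff.refl _ s).setVar h2m
    refine (Does.forLoop (N := n) (Inv := fun k => Evaluates d s
      (∃ v : Fin n, v < k ∧ φ.Holds G c (d + 1) (Function.update ρ d v)))
      (hG.agree_scratch ha₁).size (by omega) ⟨ha₁.setVar hm, by
        simp [← h₁, show (2 : ℕ) ≠ 20 + d by omega]⟩ ?_).mono le_rfl
      fun s' h => h.congr (by simp)
    rintro k s₂ hk ⟨ha₂, h2⟩ hkv h0
    have hG₂ := hG.agree_scratch ha₂
    have hstep : (∃ v : Fin n, (v : ℕ) < k + 1 ∧ φ.Holds G c (d + 1) (Function.update ρ d v)) ↔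
        (∃ v : Fin n, (v : ℕ) < k ∧ φ.Holds G c (d + 1) (Function.update ρ d v)) ∨
          φ.Holds G c (d + 1) (Function.update ρ d ⟨k, hk⟩) := by
      constructor
      · rintro ⟨v, hv, h⟩
        rcases Nat.lt_succ_iff_lt_or_eq.mp hv with hv | hv
        · exact Or.inl ⟨v, hv, h⟩
        · obtain rfl : v = ⟨k, hk⟩ := Fin.ext hv
          exact Or.inr h
      · rintro (⟨v, hv, h⟩ | h)
        · exact ⟨v, by omega, h⟩
        · exact ⟨⟨k, hk⟩, by simp, h⟩
    refine Does.ifLt (fun hlt => ?_) (fun hlt => ?_) <;> rw [hG₂.one, h2] at hlt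
    · have hno : ¬ ∃ v : Fin n, (v : ℕ) < k ∧ φ.Holds G c (d + 1) (Function.update ρ d v) :=
        fun h => by simp [h] at hlt
      have hρ' : HoldsEnv (d + 1) (Function.update ρ d ⟨k, hk⟩) s₂ := by
        intro i hi
        rcases Nat.lt_succ_iff_lt_or_eq.mp hi with hi | rfl
        · rw [Function.update_of_ne hi.ne, (hρ.agree ha₂) i hi]
        · simpa using hkv
      refine (ih hw hG₂ (hc.agree ha₂) hρ').mono (by omega) fun s₃ h₃ => ⟨?_, ?_, ?_, ?_⟩
      · rw [h₃.1.2 _ (by rw [mem_scratch]; omega), hkv]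
      · exact (hG₂.agree_scratch h₃.1).size
      · exact (ha₂.trans (h₃.1.mono scratch_mono)).setVar hm
      · rw [setVar_var, if_neg (by omega)]
        exact (h₃.congr ⟨fun h => hstep.2 (Or.inr h), fun h => (hstep.1 h).resolve_left hno⟩).2
    · have hyes : ∃ v : Fin n, (v : ℕ) < k ∧ φ.Holds G c (d + 1) (Function.update ρ d v) := by
        by_contra h; simp [h] at hlt
      refine (Does.skip ⟨hkv, h0, ha₂.setVar hm, ?_⟩).mono (by omega) fun _ h => h
      rw [setVar_var, if_neg (by omega), h2, if_pos hyes, if_pos (hstep.2 (Or.inl hyes))]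

end Evaluation

/-! ### The search program -/

section Search

open Polynomial

/-- Look for a vertex at which the guard `φ` holds. Variable `2` tells whether there is one, and
variable `8` holds it. -/
def findProg (φ : Formula) : Prog :=
  .seq (.const 2 0) (forLoop 20 0
    (.ifLt 2 1 (.seq (evalProg φ 1) (.ifLt 2 1 .skip (.copy 8 20))) .skip))

/-- Push the colouring described by `f` for the vertex in variable `20` on the stack. -/
def pushProg (f : Formula × Formula) : Prog :=
  .seq (forLoop 21 0 (.seq (evalProg f.1 2) (.seq
    (.ifLt 2 1 (.seq (evalProg f.2 2) (.ifLt 2 1 (.load 12 1 21) (.const 12 0))) (.const 12 1))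
    (.seq (.store 2 7 12) (.incr 7))))) (.incr 6)

/-- Push all colourings described by a list. -/
def pushAllProg : List (Formula × Formula) → Prog
  | [] => .skip
  | f :: fs => .seq (pushAllProg fs) (pushProg f)

/-- Apply the first applicable rule to the colouring in array `1` and push the results on the
stack. If no rule applies, write `1` to variable `10` and make the stack empty. -/
def rulesProg : List Rule → Prog
  | [] => .seq (.const 10 1) (.const 6 0)
  | r :: rs => .seq (findProg r.guard)
      (.ifLt 9 2 (.seq (.copy 20 8) (pushAllProg r.succs)) (rulesProg rs))

/-- Move the top of the stack to array `1`. -/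
def popProg : Prog :=
  .seq (.decr 6) (.seq (forLoop 13 0 (.decr 7)) (.seq (.copy 11 7)
    (forLoop 13 0 (.seq (.load 12 2 11) (.seq (.store 1 13 12) (.incr 11))))))

/-- Push the colouring without decided vertices on the empty stack. -/
def initProg : Prog :=
  .seq (.const 1 1) (.seq (forLoop 13 0 (.seq (.const 12 2) (.seq (.store 2 7 12) (.incr 7))))
    (.incr 6))

/-- The main loop. -/
def loopProg : Prog := .whileLt 9 6 (.seq popProg (rulesProg rules))

/-- The program that decides Monopolar Recognition. -/
def mainProg : Prog := .seq initProg (.seq loopProg (.copy 0 10))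

noncomputable def findCost (φ : Formula) : ℕ[X] := X * (evalCost φ + 5) + 3

noncomputable def pushCost (f : Formula × Formula) : ℕ[X] :=
  X * (evalCost f.1 + evalCost f.2 + 7) + 3

noncomputable def pushAllCost : List (Formula × Formula) → ℕ[X]
  | [] => 1
  | f :: fs => pushAllCost fs + pushCost f

noncomputable def rulesCost : List Rule → ℕ[X]
  | [] => 2
  | r :: rs => findCost r.guard + pushAllCost r.succs + rulesCost rs + 2

/-- The array `A` holds the stack `L`, whose first entry is the top. -/
def HoldsStack {n : ℕ} (A : ℕ → ℕ) : List (Fin n → ℕ) → Prop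
  | [] => True
  | c :: L => (∀ i : Fin n, A (L.length * n + i) = c i) ∧ HoldsStack A L

/-- The store holds the graph `G` and the stack `L` with its size and stack pointer. -/
structure HoldsState {n : ℕ} (G : SimpleGraph (Fin n)) (L : List (Fin n → ℕ)) (s : Store) :
    Prop where
  graph : HoldsGraph G s
  stack : HoldsStack (s.arr 2) L
  length : s.var 6 = L.length
  pointer : s.var 7 = L.length * n

variable {n : ℕ} {G : SimpleGraph (Fin n)} {c : Fin n → ℕ} {s s' : Store} {a : Fin n}
  {L : List (Fin n → ℕ)}

theorem HoldsStack.congr {A B : ℕ → ℕ} (h : HoldsStack A L)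
    (hAB : ∀ k < L.length * n, B k = A k) : HoldsStack B L := by
  induction L with
  | nil => trivial
  | cons c L ih =>
    have hlen : (c :: L).length * n = L.length * n + n := by
      rw [List.length_cons, Nat.succ_mul]
    refine ⟨fun i => ?_, ih h.2 fun k hk => hAB k (by omega)⟩
    rw [hAB _ (by have := i.2; omega), h.1 i]

theorem HoldsGraph.congr (h : HoldsGraph G s) (h0 : s'.var 0 = s.var 0) (h1 : s'.var 1 = s.var 1)
    (h9 : s'.var 9 = s.var 9) (ha : s'.arr 0 = s.arr 0) : HoldsGraph G s' where
  size := h0.trans h.size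
  one := h1.trans h.one
  zero := h9.trans h.zero
  adj := by rw [ha]; exact h.adj

theorem HoldsState.agree {X : Set ℕ} (h : HoldsState G L s) (ha : AgreeOff X s s')
    (hX : ∀ y ∈ X, 2 ≤ y ∧ y ≠ 6 ∧ y ≠ 7 ∧ y ≠ 9) : HoldsState G L s' where
  graph := h.graph.agree ha (fun h => by simpa using hX _ h) (fun h => by simpa using hX _ h)
    (fun h => by simpa using hX _ h)
  stack := by rw [ha.1]; exact h.stack
  length := by rw [ha.2 6 fun h => by simpa using hX _ h]; exact h.length
  pointer := by rw [ha.2 7 fun h => by simpa using hX _ h]; exact h.pointer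

/-- The variables changed by `findProg`. -/
def findScratch : Set ℕ := {y | (2 ≤ y ∧ y ≤ 5) ∨ y = 8 ∨ 20 ≤ y}

theorem mem_findScratch {y : ℕ} : y ∈ findScratch ↔ (2 ≤ y ∧ y ≤ 5) ∨ y = 8 ∨ 20 ≤ y := Iff.rfl

theorem scratch_subset_findScratch {d : ℕ} : scratch d ⊆ findScratch := fun y hy => by
  rw [mem_findScratch]; rw [mem_scratch] at hy; omega

theorem does_findProg {φ : Formula} (hw : φ.WellScoped 1) (hG : HoldsGraph G s)
    (hc : HoldsColouring c s) :
    Does (findProg φ) s ((findCost φ).eval n) (fun s' => AgreeOff findScratch s s' ∧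
      ((s'.var 2 = 1 ∧ ∃ a : Fin n, s'.var 8 = a ∧ φ.Holds G c 1 fun _ => a) ∨
        (s'.var 2 = 0 ∧ ∀ a : Fin n, ¬ φ.Holds G c 1 fun _ => a))) := by
  have h20 : 20 ∈ findScratch := by simp [mem_findScratch]
  have h2 : 2 ∈ findScratch := by simp [mem_findScratch]
  have h8 : 8 ∈ findScratch := by simp [mem_findScratch]
  have h0 : 0 ∉ findScratch := by simp [mem_findScratch]
  have h1 : 1 ∉ findScratch := by simp [mem_findScratch]
  have h9 : 9 ∉ findScratch := by simp [mem_findScratch]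
  simp only [findCost, eval_add, eval_mul, eval_X, eval_ofNat]
  refine (Does.seq (T := 1) (T' := n * (((evalCost φ).eval n + 2 + 1) + 2) + 2) (Does.const rfl)
    fun s₁ h₁ => ?_).mono (by ring_nf; omega) fun _ h => h
  have ha₁ : AgreeOff findScratch s s₁ := by
    rw [← h₁]; exact (AgreeOff.refl _ s).setVar h2
  refine (Does.forLoop (N := n) (Inv := fun k s' => AgreeOff findScratch s s' ∧
      ((s'.var 2 = 1 ∧ ∃ a : Fin n, s'.var 8 = a ∧ φ.Holds G c 1 fun _ => a) ∨
        (s'.var 2 = 0 ∧ ∀ a : Fin n, (a : ℕ) < k → ¬ φ.Holds G c 1 fun _ => a)))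
      (hG.agree ha₁ h0 h1 h9).size (by omega) ⟨ha₁.setVar h20, Or.inr ⟨by simp [← h₁], by simp⟩⟩
      ?_).mono le_rfl fun s' h => ?_
  · rintro k s₂ hk ⟨ha₂, h⟩ hkv hnv
    have hG₂ := hG.agree ha₂ h0 h1 h9
    refine Does.ifLt (fun hlt => ?_) (fun hlt => ?_)
    · have hno : ∀ a : Fin n, (a : ℕ) < k → ¬ φ.Holds G c 1 fun _ => a := by
        rcases h with h | h
        · rw [h.1, hG₂.one] at hlt; omega
        · exact h.2
      have hρ : HoldsEnv 1 (fun _ => (⟨k, hk⟩ : Fin n)) s₂ := by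
        intro i hi
        obtain rfl : i = 0 := by omega
        exact hkv
      refine Does.seq (does_evalProg φ hw hG₂ (hc.agree ha₂) hρ) fun s₃ h₃ => ?_
      have ha₃ := ha₂.trans (h₃.1.mono scratch_subset_findScratch)
      have hG₃ := hG.agree ha₃ h0 h1 h9
      have hk₃ : s₃.var 20 = k := by
        rw [h₃.1.2 20 (by simp [mem_scratch]), hkv]
      refine Does.ifLt (fun hlt' => Does.skip ?_) (fun hlt' => Does.copy ?_)
      · rw [hG₃.one, Nat.lt_one_iff] at hlt'
        refine ⟨hk₃, hG₃.size, ha₃.setVar h20, Or.inr ⟨by simpa using hlt', fun a ha => ?_⟩⟩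
        rcases Nat.lt_succ_iff_lt_or_eq.mp ha with ha | ha
        · exact hno a ha
        · obtain rfl : a = ⟨k, hk⟩ := Fin.ext ha
          intro hφ
          rw [h₃.2, if_pos hφ] at hlt'
          omega
      · have hφ : φ.Holds G c 1 fun _ => (⟨k, hk⟩ : Fin n) := by
          by_contra hφ
          rw [hG₃.one, h₃.2, if_neg hφ] at hlt'
          omega
        refine ⟨by simpa using hk₃, by simpa using hG₃.size, (ha₃.setVar h8).setVar h20,
          Or.inl ⟨?_, ⟨k, hk⟩, by simpa using hk₃, hφ⟩⟩
        have := h₃.2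
        rw [if_pos hφ] at this
        simpa using this
    · have hyes : s₂.var 2 = 1 ∧ ∃ a : Fin n, s₂.var 8 = a ∧ φ.Holds G c 1 fun _ => a := by
        rcases h with h | h
        · exact h
        · rw [h.1, hG₂.one] at hlt; omega
      exact (Does.skip ⟨hkv, hnv, ha₂.setVar h20, Or.inl (by simpa using hyes)⟩).mono
        (by omega) fun _ h => h
  · refine ⟨h.1, h.2.imp id fun h => ⟨h.1, fun a => h.2 a a.2⟩⟩

/-- What stays fixed while colourings are pushed: the adjacency matrix, the colouring, and the
variables that are still needed. -/
structure PushFrame (s s' : Store) : Prop where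
  arr_zero : s'.arr 0 = s.arr 0
  arr_one : s'.arr 1 = s.arr 1
  var : ∀ y ∈ ({0, 1, 9, 10, 20} : Set ℕ), s'.var y = s.var y

theorem PushFrame.refl (s : Store) : PushFrame s s := ⟨rfl, rfl, fun _ _ => rfl⟩

theorem PushFrame.trans {s'' : Store} (h : PushFrame s s') (h' : PushFrame s' s'') :
    PushFrame s s'' :=
  ⟨h'.1.trans h.1, h'.2.trans h.2, fun y hy => (h'.3 y hy).trans (h.3 y hy)⟩

theorem PushFrame.setVar (h : PushFrame s s') {x v : ℕ} (hx : x ∉ ({0, 1, 9, 10, 20} : Set ℕ)) :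
    PushFrame s (s'.setVar x v) :=
  ⟨h.1, h.2, fun y hy => by
    have : y ≠ x := fun e => hx (e ▸ hy)
    simp [this, h.3 y hy]⟩

theorem PushFrame.setArr (h : PushFrame s s') {i v : ℕ} : PushFrame s (s'.setArr 2 i v) :=
  ⟨by ext j; simp [h.1], by ext j; simp [h.2], fun y hy => by simp [h.3 y hy]⟩

theorem PushFrame.agree {s'' : Store} (h : PushFrame s s') (ha : AgreeOff (scratch 2) s' s'') :
    PushFrame s s'' := by
  refine h.trans ⟨by rw [ha.1], by rw [ha.1], fun y hy => ha.2 y fun hy' => ?_⟩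
  rw [mem_scratch] at hy'
  simp only [Set.mem_insert_iff, Set.mem_singleton_iff] at hy
  omega

theorem PushFrame.holdsGraph (h : PushFrame s s') (hG : HoldsGraph G s) : HoldsGraph G s' :=
  hG.congr (h.3 0 (by simp)) (h.3 1 (by simp)) (h.3 9 (by simp)) h.1

theorem PushFrame.holdsColouring (h : PushFrame s s') (hc : HoldsColouring c s) :
    HoldsColouring c s' := fun i => by rw [h.2, hc i]

theorem does_pushProg {f : Formula × Formula} (hw : f.1.WellScoped 2 ∧ f.2.WellScoped 2)
    (hS : HoldsState G L s) (hc : HoldsColouring c s) (ha : s.var 20 = a) :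
    Does (pushProg f) s ((pushCost f).eval n)
      (fun s' => HoldsState G (recolour G c a f :: L) s' ∧ PushFrame s s') := by
  simp only [pushCost, eval_add, eval_mul, eval_X, eval_ofNat]
  set T := (evalCost f.1).eval n with hT
  set T' := (evalCost f.2).eval n with hT'
  refine (Does.seq (T := n * ((T + ((T' + 2 + 1) + 2)) + 2) + 2) (T' := 1) (Does.forLoop (N := n)
    (Inv := fun k s' => PushFrame s s' ∧ s'.var 6 = L.length ∧ s'.var 7 = L.length * n + k ∧
      (∀ j < L.length * n, s'.arr 2 j = s.arr 2 j) ∧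
      ∀ i : Fin n, (i : ℕ) < k → s'.arr 2 (L.length * n + i) = recolour G c a f i)
    hS.graph.size (by omega)
    ⟨(PushFrame.refl s).setVar (by simp), by simpa using hS.length, by simpa using hS.pointer,
      by simp, by simp⟩ ?_) fun s₁ h₁ => ?_).mono (by ring_nf; omega) fun _ h => h
  · rintro k s₁ hk ⟨hF, h6, h7, hold, hnew⟩ h21 h0
    have hG₁ := hF.holdsGraph hS.graph
    have hρ : HoldsEnv 2 (Function.update (fun _ => a) 1 ⟨k, hk⟩) s₁ := by
      intro i hi
      obtain rfl | rfl : i = 0 ∨ i = 1 := by omega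
      · simpa [ha] using hF.3 20 (by simp)
      · simpa using h21
    refine Does.seq (does_evalProg f.1 hw.1 hG₁ (hF.holdsColouring hc) hρ) fun s₂ h₂ => ?_
    have hF₂ := hF.agree h₂.1
    have hG₂ := hF₂.holdsGraph hS.graph
    -- the new colour of vertex `k` goes to variable `12`
    refine Does.seq (Q := fun s₃ => PushFrame s s₃ ∧ s₃.arr = s₁.arr ∧
      (∀ y ∈ ({6, 7, 21} : Set ℕ), s₃.var y = s₁.var y) ∧
        s₃.var 12 = recolour G c a f ⟨k, hk⟩) (Does.ifLt (fun hlt => ?_) (fun hlt => ?_))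
      fun s₃ h₃ => ?_
    · have hf1 : ¬ f.1.Holds G c 2 (Function.update (fun _ => a) 1 ⟨k, hk⟩) := fun h => by
        rw [hG₂.one, h₂.2, if_pos h] at hlt; omega
      refine Does.seq (does_evalProg f.2 hw.2 hG₂ (hF₂.holdsColouring hc) (hρ.agree h₂.1))
        fun s₃ h₃ => ?_
      have hF₃ := hF₂.agree h₃.1
      have hG₃ := hF₃.holdsGraph hS.graph
      have h13 := h₂.1.trans h₃.1
      have hv : ∀ y ∈ ({6, 7, 21} : Set ℕ), s₃.var y = s₁.var y := fun y hy => by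
        refine h13.2 y fun hy' => ?_
        rw [mem_scratch] at hy'
        simp only [Set.mem_insert_iff, Set.mem_singleton_iff] at hy
        omega
      refine Does.ifLt (fun hlt' => Does.load ?_) (fun hlt' => Does.const ?_)
      · have hf2 : ¬ f.2.Holds G c 2 (Function.update (fun _ => a) 1 ⟨k, hk⟩) := fun h => by
          rw [hG₃.one, h₃.2, if_pos h] at hlt'; omega
        refine ⟨hF₃.setVar (by simp), h13.1, fun y hy => ?_, ?_⟩
        · rw [setVar_var, if_neg (by rintro rfl; simp at hy), hv y hy]
        · rw [recolour, if_neg hf1, if_neg hf2, setVar_var, if_pos rfl, hv 21 (by simp), h21]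
          exact hF₃.holdsColouring hc ⟨k, hk⟩
      · have hf2 : f.2.Holds G c 2 (Function.update (fun _ => a) 1 ⟨k, hk⟩) := by
          by_contra h
          rw [hG₃.one, h₃.2, if_neg h] at hlt'; omega
        refine ⟨hF₃.setVar (by simp), h13.1, fun y hy => ?_, ?_⟩
        · rw [setVar_var, if_neg (by rintro rfl; simp at hy), hv y hy]
        · rw [recolour, if_neg hf1, if_pos hf2, setVar_var, if_pos rfl]
    · have hf1 : f.1.Holds G c 2 (Function.update (fun _ => a) 1 ⟨k, hk⟩) := by
        by_contra h
        rw [hG₂.one, h₂.2, if_neg h] at hlt; omega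
      refine (Does.const ?_).mono (by omega) fun _ h => h
      refine ⟨hF₂.setVar (by simp), h₂.1.1, fun y hy => ?_, ?_⟩
      · rw [setVar_var, if_neg (by rintro rfl; simp at hy)]
        refine h₂.1.2 y fun hy' => ?_
        rw [mem_scratch] at hy'
        simp only [Set.mem_insert_iff, Set.mem_singleton_iff] at hy
        omega
      · rw [recolour, if_pos hf1, setVar_var, if_pos rfl]
    · obtain ⟨hF₃, harr, hv, h12⟩ := h₃
      have h6' := hv 6 (by simp)
      have h7' := hv 7 (by simp)
      have h21' := hv 21 (by simp)
      refine Does.seq (T := 1) (T' := 1) (Does.store rfl) fun s₄ h₄ => Does.incr ?_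
      subst h₄
      refine ⟨by simp [h21', h21], ?_, ?_, by simp [h6', h6], by simp [h7', h7]; omega, ?_, ?_⟩
      · simpa using (hF₃.holdsGraph hS.graph).size
      · exact (hF₃.setArr.setVar (by simp)).setVar (by simp)
      · intro j hj
        simp only [setVar_arr, setArr_arr, h7', h7, harr]
        rw [if_neg (by omega), hold j hj]
      · intro i hi
        simp only [setVar_arr, setArr_arr, h7', h7, harr, true_and]
        rcases Nat.lt_succ_iff_lt_or_eq.mp hi with hi | hi
        · rw [if_neg (by omega), hnew i hi]
        · obtain rfl : i = ⟨k, hk⟩ := Fin.ext hi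
          rw [if_pos rfl, h12]
  · obtain ⟨hF, h6, h7, hold, hnew⟩ := h₁
    refine Does.incr ⟨⟨?_, ⟨fun i => ?_, ?_⟩, ?_, ?_⟩, hF.setVar (by simp)⟩
    · exact (hF.holdsGraph hS.graph).congr (by simp) (by simp) (by simp) rfl
    · exact hnew i i.2
    · exact hS.stack.congr hold
    · simp [h6]
    · simp [h7]; ring

theorem does_pushAllProg {fs : List (Formula × Formula)}
    (hw : ∀ f ∈ fs, f.1.WellScoped 2 ∧ f.2.WellScoped 2) (hS : HoldsState G L s)
    (hc : HoldsColouring c s) (ha : s.var 20 = a) :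
    Does (pushAllProg fs) s ((pushAllCost fs).eval n)
      (fun s' => HoldsState G (fs.map (recolour G c a) ++ L) s' ∧ PushFrame s s') := by
  induction fs with
  | nil =>
    simp only [pushAllCost, eval_one]
    exact Does.skip ⟨hS, PushFrame.refl s⟩
  | cons f fs ih =>
    simp only [pushAllCost, eval_add]
    refine Does.seq (ih fun g hg => hw g (by simp [hg])) fun s₁ h₁ => ?_
    refine (does_pushProg (hw f (by simp)) h₁.1 (h₁.2.holdsColouring hc)
      ((h₁.2.3 20 (by simp)).trans ha)).mono le_rfl fun s₂ h₂ => ⟨h₂.1, h₁.2.trans h₂.2⟩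

/-- All formulas of a rule are well scoped. -/
def Rule.WellScoped (r : Rule) : Prop :=
  r.guard.WellScoped 1 ∧ ∀ f ∈ r.succs, f.1.WellScoped 2 ∧ f.2.WellScoped 2

/-- The outcome of `rulesProg`. -/
def StepOutcome (G : SimpleGraph (Fin n)) (c : Fin n → ℕ) (L : List (Fin n → ℕ))
    (o : Option (List (Fin n → ℕ))) (s : Store) : Prop :=
  match o with
  | none => s.var 10 = 1 ∧ s.var 6 = 0 ∧ s.var 9 = 0 ∧ HoldsColouring c s
  | some L' => HoldsState G (L' ++ L) s ∧ s.var 10 = 0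

theorem does_rulesProg {rs : List Rule} (hw : ∀ r ∈ rs, r.WellScoped) : ∀ {s : Store},
    HoldsState G L s → HoldsColouring c s → s.var 10 = 0 →
    Does (rulesProg rs) s ((rulesCost rs).eval n)
      (fun s' => ∃ o, Step G c rs o ∧ StepOutcome G c L o s') := by
  induction rs with
  | nil =>
    intro s hS hc h10
    simp only [rulesCost, eval_ofNat]
    refine Does.seq (T := 1) (T' := 1) (Does.const rfl) fun s₁ h₁ => Does.const ?_
    subst h₁
    exact ⟨none, rfl, by simp, by simp, by simpa using hS.graph.zero, hc⟩
  | cons r rs ih =>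
    intro s hS hc h10
    simp only [rulesCost, eval_add, eval_ofNat]
    refine (Does.seq (does_findProg (hw r (by simp)).1 hS.graph hc)
      (T' := (pushAllCost r.succs).eval n + (rulesCost rs).eval n + 1 + 1)
      fun s₁ ⟨ha, h⟩ => ?_).mono (by omega) fun _ h => h
    have hS₁ : HoldsState G L s₁ := hS.agree ha fun y hy => by
      rw [mem_findScratch] at hy; omega
    have hc₁ := hc.agree ha
    have h10₁ : s₁.var 10 = 0 := by rw [ha.2 10 (by simp [mem_findScratch]), h10]
    refine Does.ifLt (fun hlt => ?_) (fun hlt => ?_) <;> rw [hS₁.graph.zero] at hlt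
    · obtain ⟨a, h8, hφ⟩ : ∃ a : Fin n, s₁.var 8 = a ∧ r.guard.Holds G c 1 fun _ => a := by
        rcases h with h | h
        · exact h.2
        · omega
      refine (Does.seq (T := 1) (Does.copy rfl) fun s₂ h₂ => ?_).mono (T :=
        1 + (pushAllCost r.succs).eval n) (by omega) fun _ h => h
      have ha₂ : AgreeOff {20} s₁ s₂ := by
        rw [← h₂]; exact (AgreeOff.refl _ s₁).setVar rfl
      refine (does_pushAllProg (a := a) (hw r (by simp)).2 (hS₁.agree ha₂ (by simp))
        (hc₁.agree ha₂) (by simp [← h₂, h8])).mono le_rfl fun s₃ h₃ => ?_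
      refine ⟨some (r.succs.map (recolour G c a)), Or.inl ⟨a, hφ, rfl⟩, h₃.1, ?_⟩
      rw [h₃.2.3 10 (by simp), ← h₂]
      simpa using h10₁
    · have hno : ∀ a : Fin n, ¬ r.guard.Holds G c 1 fun _ => a := by
        rcases h with h | h
        · omega
        · exact h.2
      refine (ih (fun r' hr' => hw r' (by simp [hr'])) hS₁ hc₁ h10₁).mono (by omega)
        fun s₂ ⟨o, ho, hs₂⟩ => ⟨o, Or.inr ⟨fun ⟨a, ha⟩ => hno a ha, ho⟩, hs₂⟩

theorem does_popProg (hS : HoldsState G (c :: L) s) (h10 : s.var 10 = 0) :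
    Does popProg s (n * 8 + 6)
      (fun s' => HoldsState G L s' ∧ HoldsColouring c s' ∧ s'.var 10 = 0) := by
  have hlen : (c :: L).length * n = L.length * n + n := by
    rw [List.length_cons, Nat.succ_mul]
  refine (Does.seq (T := 1) (T' := (n * (1 + 2) + 2) + (1 + (n * (1 + (1 + 1) + 2) + 2)))
    (Does.decr rfl) fun s₁ h₁ => ?_).mono (by omega) fun _ h => h
  -- variable `11` runs through the cells of the top entry
  refine Does.seq (Does.forLoop (N := n) (Inv := fun k s' => s'.arr = s.arr ∧
    (∀ y ∈ ({0, 1, 9, 10} : Set ℕ), s'.var y = s.var y) ∧ s'.var 6 = L.length ∧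
      s'.var 7 = L.length * n + (n - k)) (by simpa [← h₁] using hS.graph.size) (by omega)
      ⟨by simp [← h₁], ?_, by simp [← h₁, hS.length], ?_⟩ ?_) fun s₂ ⟨harr, hv, h6, h7⟩ => ?_
  · intro y hy
    simp only [Set.mem_insert_iff, Set.mem_singleton_iff] at hy
    rw [← h₁]
    simp only [setVar_var]
    rw [if_neg (by omega), if_neg (by omega)]
  · rw [← h₁]
    simp [hS.pointer]
    ring
  · rintro k s₂ hk ⟨harr, hv, h6, h7⟩ h13 h0
    refine Does.decr ⟨by simp [h13], by simp [h0], harr, ?_, by simp [h6], by simp [h7]; omega⟩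
    intro y hy
    have := hv y hy
    simp only [Set.mem_insert_iff, Set.mem_singleton_iff] at hy
    simp only [setVar_var]
    rw [if_neg (by omega), if_neg (by omega), this]
  refine Does.seq (Does.copy rfl) fun s₃ h₃ => ?_
  refine (Does.forLoop (N := n) (Inv := fun k s' => s'.arr 0 = s.arr 0 ∧ s'.arr 2 = s.arr 2 ∧
    (∀ y ∈ ({0, 1, 9, 10} : Set ℕ), s'.var y = s.var y) ∧ s'.var 6 = L.length ∧
      s'.var 7 = L.length * n ∧ s'.var 11 = L.length * n + k ∧
      ∀ i : Fin n, (i : ℕ) < k → s'.arr 1 i = c i) ?_ (by omega) ?_ ?_).mono le_rfl ?_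
  · rw [← h₃]
    simpa [hv 0 (by simp)] using hS.graph.size
  · subst h₃
    refine ⟨by simp [harr], by simp [harr], ?_, by simp [h6], by simp [h7], by simp [h7], by simp⟩
    intro y hy
    have := hv y hy
    simp only [Set.mem_insert_iff, Set.mem_singleton_iff] at hy
    simp only [setVar_var]
    rw [if_neg (by omega), if_neg (by omega), this]
  · rintro k s₄ hk ⟨ha0, ha2, hv, h6, h7, h11, hnew⟩ h13 h0
    refine Does.seq (T := 1) (T' := 1 + 1) (Does.load rfl) fun s₅ h₅ =>
      Does.seq (T := 1) (T' := 1) (Does.store rfl) fun s₆ h₆ => Does.incr ?_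
    have hcell : s₄.arr 2 (L.length * n + k) = c ⟨k, hk⟩ := by
      rw [ha2]; exact hS.stack.1 ⟨k, hk⟩
    subst h₅ h₆
    refine ⟨by simp [h13], by simp [h0], ?_, ?_, ?_, by simp [h6], by simp [h7],
      by simp [h11]; omega, ?_⟩
    · ext j; simp [ha0]
    · ext j; simp [ha2]
    · intro y hy
      have := hv y hy
      simp only [Set.mem_insert_iff, Set.mem_singleton_iff] at hy
      simp only [setVar_var, setArr_var]
      rw [if_neg (by omega), if_neg (by omega), if_neg (by omega), this]
    · intro i hi
      simp only [setVar_arr, setArr_arr, setVar_var, h13, h11, hcell,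
        if_neg (show ¬ (13 : ℕ) = 12 by decide)]
      rcases Nat.lt_succ_iff_lt_or_eq.mp hi with hi | hi
      · rw [if_neg (by omega), hnew i hi]
      · obtain rfl : i = ⟨k, hk⟩ := Fin.ext hi
        simp
  · rintro s₄ ⟨ha0, ha2, hv, h6, h7, -, hnew⟩
    refine ⟨⟨hS.graph.congr (hv 0 (by simp)) (hv 1 (by simp)) (hv 9 (by simp)) ha0, ?_, h6, h7⟩,
      fun i => hnew i i.2, by rw [hv 10 (by simp), h10]⟩
    rw [ha2]
    exact hS.stack.2

theorem wellScoped_rules : ∀ r ∈ rules, r.WellScoped := by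
  simp only [rules, earlyRules, List.cons_append, List.nil_append, List.mem_cons,
    List.not_mem_nil, or_false, forall_eq_or_imp, forall_eq]
  refine ⟨?_, ?_, ?_, ?_, ?_, ?_, ?_, ?_, ?_, ?_, ?_, ?_, ?_⟩ <;>
    exact ⟨by decide, by decide⟩

end Search

/-! ### Correctness and running time of the search -/

section Correctness

open Polynomial

/-- A bound for the running time of one iteration of the main loop. -/
noncomputable def iterationCost : ℕ[X] := X * 8 + 7 + rulesCost rules

/-- A bound for the running time of `initProg`. -/
noncomputable def initCost : ℕ[X] := X * 5 + 4

variable {n : ℕ} {G : SimpleGraph (Fin n)} {c : Fin n → ℕ} {s : Store} {L : List (Fin n → ℕ)}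

/-- The answer in variable `10` (and array `1`) is correct for the colourings in `L`. -/
def Answers (G : SimpleGraph (Fin n)) (L : List (Fin n → ℕ)) (s : Store) : Prop :=
  (s.var 10 = 1 ∧ IsMonopolarPartition G {v | s.arr 1 v.val = 1} {v | s.arr 1 v.val = 0}) ∨
    (s.var 10 = 0 ∧ ∀ c ∈ L, ¬ Solvable G c)

/-- The main loop makes at most as many iterations as the total weight of the stack. -/
theorem does_loopProg (N : ℕ) : ∀ {L : List (Fin n → ℕ)} {s : Store}, HoldsState G L s →
    s.var 10 = 0 → (L.map (weight G)).sum ≤ N →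
    Does loopProg s (N * iterationCost.eval n + 1) (Answers G L) := by
  induction N with
  | zero =>
    intro L s hS h10 hN
    cases L with
    | nil =>
      exact ⟨1, s, .whileFalse (by rw [hS.length]; simp), by omega, Or.inr ⟨h10, by simp⟩⟩
    | cons c L =>
      exfalso
      simp only [List.map_cons, List.sum_cons, Nat.cast_zero] at hN
      have h1 : 0 ≤ (L.map (weight G)).sum :=
        List.sum_nonneg fun x hx => by
          obtain ⟨c, -, rfl⟩ := List.mem_map.mp hx
          exact weight_pos.le
      have := weight_pos (G := G) (s := c)
      linarith
  | succ N ih =>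
    intro L s hS h10 hN
    cases L with
    | nil =>
      exact ⟨1, s, .whileFalse (by rw [hS.length]; simp), by omega, Or.inr ⟨h10, by simp⟩⟩
    | cons c L =>
      have hbody : Does (.seq popProg (rulesProg rules)) s (n * 8 + 6 + (rulesCost rules).eval n)
          (fun s' => ∃ o, Step G c rules o ∧ StepOutcome G c L o s') :=
        Does.seq (does_popProg hS h10) fun s₁ h₁ =>
          does_rulesProg wellScoped_rules h₁.1 h₁.2.1 h₁.2.2
      obtain ⟨t, s₁, hr, ht, o, ho, hs₁⟩ := hbody
      have hlt : s.var 9 < s.var 6 := by rw [hS.graph.zero, hS.length]; simp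
      have hcost : iterationCost.eval n = n * 8 + 7 + (rulesCost rules).eval n := by
        simp [iterationCost]
      cases o with
      | none =>
        obtain ⟨h10', h6, h9, hc⟩ := hs₁
        refine ⟨_, s₁, .whileTrue hlt hr (.whileFalse (by omega)), ?_, Or.inl ⟨h10', ?_⟩⟩
        · rw [Nat.succ_mul, hcost]
          omega
        · simp only [hc _]
          exact ho.none
      | some L' =>
        obtain ⟨hsol, hw⟩ := ho.some
        obtain ⟨t', s₂, hr', ht', hans⟩ := ih hs₁.1 hs₁.2 (by
          simp only [List.map_append, List.sum_append, List.map_cons, List.sum_cons,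
            Nat.cast_succ] at hN ⊢
          linarith)
        refine ⟨_, s₂, .whileTrue hlt hr hr', ?_, hans.imp id fun h => ⟨h.1, fun d hd hsolv => ?_⟩⟩
        · rw [Nat.succ_mul]
          omega
        · rcases List.mem_cons.mp hd with rfl | hd
          · obtain ⟨e, he, hsolv'⟩ := hsol hsolv
            exact h.2 e (by simp [he]) hsolv'
          · exact h.2 d (by simp [hd]) hsolv

/-- The adjacency matrix is stored without overlaps. -/
theorem holdsGraph_inputStore (h0 : s.var 0 = n) (h1 : s.var 1 = 1) (h9 : s.var 9 = 0)
    (ha : s.arr 0 = (inputStore G).arr 0) : HoldsGraph G s where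
  size := h0
  one := h1
  zero := h9
  adj i j := by
    rw [ha]
    constructor
    · intro h
      exact if_pos ⟨rfl, i, j, h, rfl⟩
    · intro h
      refine if_neg ?_
      rintro ⟨-, i', j', h', he⟩
      have hdiv : ∀ i j : Fin n, ((i : ℕ) * n + j) / n = i := fun i j => by
        rw [mul_comm, Nat.mul_add_div j.pos, Nat.div_eq_of_lt j.2, add_zero]
      have hi : i = i' := Fin.ext (by rw [← hdiv i j, he, hdiv])
      subst hi
      have hj : j = j' := Fin.ext (by omega)
      subst hj
      exact h h'

theorem does_initProg : Does initProg (inputStore G) (initCost.eval n)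
    (fun s => HoldsState G [fun _ => 2] s ∧ s.var 10 = 0) := by
  simp only [initCost, eval_add, eval_mul, eval_X, eval_ofNat]
  refine (Does.seq (T := 1) (T' := (n * (1 + (1 + 1) + 2) + 2) + 1) (Does.const rfl)
    fun s₁ h₁ => ?_).mono (by omega) fun _ h => h
  subst h₁
  refine Does.seq (Does.forLoop (N := n) (Inv := fun k s => s.arr 0 = (inputStore G).arr 0 ∧
    s.var 0 = n ∧ s.var 1 = 1 ∧ s.var 6 = 0 ∧ s.var 9 = 0 ∧ s.var 10 = 0 ∧ s.var 7 = k ∧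
      ∀ i < k, s.arr 2 i = 2) (by simp [inputStore]) (by omega) (by simp [inputStore]) ?_)
      fun s₂ ⟨ha, h0, h1, h6, h9, h10, h7, hnew⟩ => Does.incr ?_
  · rintro k s₂ hk ⟨ha, h0, h1, h6, h9, h10, h7, hnew⟩ h13 -
    refine Does.seq (T := 1) (T' := 1 + 1) (Does.const rfl) fun s₃ h₃ =>
      Does.seq (T := 1) (T' := 1) (Does.store rfl) fun s₄ h₄ => Does.incr ?_
    subst h₃ h₄
    refine ⟨by simp [h13], by simp [h0], ?_, by simp [h0], by simp [h1], by simp [h6],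
      by simp [h9], by simp [h10], by simp [h7], ?_⟩
    · ext j; simp [ha]
    · intro i hi
      rcases Nat.lt_succ_iff_lt_or_eq.mp hi with hi | rfl
      · simp [hnew i hi]
      · simp [h7]
  · refine ⟨⟨holdsGraph_inputStore (by simp [h0]) (by simp [h1]) (by simp [h9]) (by simp [ha]),
      ⟨fun i => ?_, trivial⟩, by simp [h6], by simp [h7]⟩, by simp [h10]⟩
    simpa using hnew i i.2

theorem isMonopolar_iff_solvable : IsMonopolar G ↔ Solvable G (fun _ => 2) := by
  simp [isMonopolar_iff, Solvable, Extends]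

theorem does_mainProg {N : ℕ} (hN : (100 : ℝ) * 1.3734 ^ n ≤ N) :
    Does mainProg (inputStore G) (initCost.eval n + (N * iterationCost.eval n + 2))
      (IsCorrectOutput G) := by
  refine Does.seq does_initProg fun s₁ h₁ => ?_
  refine Does.seq (T' := 1) (does_loopProg N h₁.1 h₁.2 ?_) fun s₂ h₂ => Does.copy ?_
  · have hle : freeCard (fun _ : Fin n => 2) ≤ n := by
      unfold freeCard
      exact (Finset.card_le_univ _).trans (by simp)
    have : (1.3734 : ℝ) ^ freeCard (fun _ : Fin n => 2) ≤ 1.3734 ^ n :=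
      pow_le_pow_right₀ (by norm_num) hle
    have := weight_le (G := G) (s := fun _ : Fin n => 2)
    simp only [List.map_cons, List.map_nil, List.sum_cons, List.sum_nil, add_zero]
    linarith
  · rcases h₂ with ⟨h10, hpart⟩ | ⟨h10, hno⟩
    · exact ⟨fun _ => ⟨by simp [h10], hpart⟩, fun hG => absurd ⟨_, _, hpart⟩ hG⟩
    · have hG : ¬ IsMonopolar G := fun h => hno _ (by simp) (isMonopolar_iff_solvable.mp h)
      exact ⟨fun h => absurd h hG, fun _ => by simp [h10]⟩

end Correctness

end MonopolarRecognition

open MonopolarRecognition in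
/-- One program decides, for every graph on `n` vertices, whether it is monopolar, outputs a
monopolar partition if it is, and halts after at most `p(n) * 1.3734 ^ n` steps for a fixed
polynomial `p`. -/
theorem theorem1 :
    ∃ (P : Prog) (p : Polynomial ℕ), ∀ (n : ℕ) (G : SimpleGraph (Fin n)),
      ∃ (t : ℕ) (s : Store), Runs P (inputStore G) t s ∧
        (t : ℝ) ≤ ((p.eval n : ℕ) : ℝ) * (1.3734 : ℝ) ^ n ∧ IsCorrectOutput G s := by
  refine ⟨mainProg, initCost + 101 * iterationCost + 2, fun n G => ?_⟩
  obtain ⟨t, s, hr, ht, hs⟩ := does_mainProg (G := G) (Nat.le_ceil ((100 : ℝ) * 1.3734 ^ n))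
  refine ⟨t, s, hr, ?_, hs⟩
  have hX : (1 : ℝ) ≤ 1.3734 ^ n := one_le_pow₀ (by norm_num)
  have hceil : (⌈(100 : ℝ) * 1.3734 ^ n⌉₊ : ℝ) ≤ 101 * 1.3734 ^ n := by
    have := Nat.ceil_lt_add_one (show (0 : ℝ) ≤ 100 * 1.3734 ^ n by positivity)
    linarith
  have ht' : (t : ℝ) ≤ initCost.eval n + (⌈(100 : ℝ) * 1.3734 ^ n⌉₊ * iterationCost.eval n + 2) := by
    exact_mod_cast ht
  simp only [Polynomial.eval_add, Polynomial.eval_mul, Polynomial.eval_ofNat, Nat.cast_add,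
    Nat.cast_mul, Nat.cast_ofNat]
  have h1 : (0 : ℝ) ≤ (initCost.eval n : ℕ) := Nat.cast_nonneg _
  have h2 : (0 : ℝ) ≤ (iterationCost.eval n : ℕ) := Nat.cast_nonneg _
  have h3 := mul_le_mul_of_nonneg_right hceil h2
  have h4 := mul_le_mul_of_nonneg_left hX h1
  linarith
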